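/- Let $n\ge 1$ and let $A$ be a real $n\times n$ matrix, diagonalizable over $\mathbb R$ with positive eigenvalues: $A=S^{-1}A_0S$ with $S$ real and invertible and $A_0=\mathrm{diag}[\Lambda_1,\dots,\Lambda_n]$, $0<\Lambda_1\le\dots\le\Lambda_n$. Let $\alpha>0$ and let $H:\mathbb R^n\setminus\{0\}\to\mathbb R$ be positively homogeneous of degree $\alpha$ (that is, $H(sx)=s^\alpha H(x)$ for all $s>0$, $x\neq0$), positive and continuous on the unit sphere. Here $|\cdot|$ is the Euclidean norm of vectors and $\|M\|=(\sum_{i,j}m_{ij}^2)^{1/2}$ for matrices. For real $\Lambda$ let $\widehat R_\Lambda$ be the diagonal matrix whose $i$-th diagonal entry is $1$ if $\Lambda_i=\Lambda$ and $0$ otherwise, and let $R_\Lambda=S^{-1}\widehat R_\Lambda S$. Let $0\le t_0<T_*<\infty$ and let $y\in C^1([t_0,T_*),\mathbb R^n)$ satisfy $y(t)\ne0$ for all $t\in[t_0,T_*)$, $|y(t)|\to\infty$ as $t\to T_*^-$, and $$y'=H(y)Ay+f(t)\quad\text{on }(t_0,T_*),$$ where $f:[t_0,T_*)\to\mathbb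 R^n$ is continuous and $|f(t)|\le|y(t)|^{1+\alpha}E_0(t)$ on $[t_0,T_*)$ for some integrable $E_0:[t_0,T_*)\to[0,\infty)$ such that $$\int_{t_0}^{T_*}\frac{E_0(s)}{T_*-s}\ln\Big(\frac{T_*-t_0}{T_*-s}\Big)\,ds<\infty,$$ and, in the case $\Lambda_1<\Lambda_n$, also $\int_{t_0}^{T_*}(T_*-s)^{-1}E_0^2(s)\,ds<\infty$. Set $\widetilde v(t)=Sy(t)/|Sy(t)|$, $\widetilde E_0(t)=\|S\|\,\|S^{-1}\|^{\alpha+1}E_0(t)$ and $\widetilde E_1(t)=\int_t^{T_*}\frac{\widetilde E_0(\tau)}{T_*-\tau}\,d\tau$. Then there are a unique eigenvalue $\Lambda$ of $A$ and a unique unit vector $\widetilde v_*$ such that, as $t\to T_*^-$, $$\widetilde V_1(t):=|(I_n-\widehat R_\Lambda)\widetilde v(t)|\to0\quad\text{and}\quad|\widehat R_\Lambda\widetilde v(t)-\widetilde v_*|=\mathcal O(\widetilde V_1(t)+\widetilde E_1(t)).$$ For these $\Lambda$ and $\widetilde v_*$ put $v_*=S^{-1}\widetilde v_*$ and $\widetilde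 V_2(t)=|\widetilde v(t)-\widetilde v_*|$. Let $s_0>0$ and let $\omega:[0,s_0]\to[0,\infty)$ be any nondecreasing function with $\lim_{s\to0}\omega(s)=\omega(0)=0$ and $$|H(x)-H(v_*)|\le\omega(|x-v_*|)\quad\text{for all }x\in\mathbb R^n\setminus\{0\}\text{ with }|x-v_*|\le s_0 .$$ Let $T_1\in[t_0,T_*)$ be such that $\|S^{-1}\|\widetilde V_2(t)\le s_0$ for all $t\in[T_1,T_*)$, and for $t\in[T_1,T_*)$ define $$\widetilde{\mathcal E}_0(t)=\omega(\|S^{-1}\|\widetilde V_2(t))+\widetilde V_1(t)+\widetilde E_0(t),\qquad \widetilde{\mathcal E}_1(t)=\int_t^{T_*}\frac{\widetilde{\mathcal E}_0(\tau)}{T_*-\tau}\,d\tau .$$ Assume $\int_{T_1}^{T_*}\frac{\widetilde{\mathcal E}_0(\tau)}{T_*-\tau}\,d\tau<\infty$. Then there is a vector $\xi_*\in\mathbb R^n\setminus\{0\}$ with $$\lim_{t\to T_*^-}(T_*-t)^{1/\alpha}y(t)=\xi_*,\qquad A\xi_*=\Lambda\xi_*,\qquad \alpha\Lambda H(\xi_*)=1,$$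 and, as $t\to T_*^-$, $$(T_*-t)^{1/\alpha}|(I_n-R_\Lambda)y(t)|=\mathcal O(\widetilde V_1(t)),\qquad |(T_*-t)^{1/\alpha}R_\Lambda y(t)-\xi_*|=\mathcal O(\widetilde{\mathcal E}_1(t)),$$ $$|(T_*-t)^{1/\alpha}y(t)-\xi_*|=\mathcal O(\widetilde V_1(t)+\widetilde{\mathcal E}_1(t)).$$ -/

import Mathlib

open Set Filter Topology MeasureTheory Asymptotics

noncomputable section

namespace BlowUp

/-- The Euclidean (Frobenius) norm of a real square matrix. -/
def frobNorm {n : ℕ} (M : Matrix (Fin n) (Fin n) ℝ) : ℝ :=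
  Real.sqrt (∑ i, ∑ j, M i j ^ 2)

/-- `H` restricted to `ℝⁿ \ {0}` is positively homogeneous of degree `β`
(the value `H 0` plays no role). -/
def PosHomogeneous {n : ℕ} (β : ℝ) (H : EuclideanSpace ℝ (Fin n) → ℝ) : Prop :=
  ∀ x : EuclideanSpace ℝ (Fin n), x ≠ 0 → ∀ t : ℝ, 0 < t → H (t • x) = t ^ β * H x

/-- `A = S⁻¹ diag[L₁, …, Lₙ] S` with `S` invertible and `0 < L₁ ≤ … ≤ Lₙ`. -/
structure IsPosDiagonalization {n : ℕ} (A S : Matrix (Fin n) (Fin n) ℝ) (L : Fin n → ℝ) :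
    Prop where
  isUnit_det : IsUnit S.det
  mono : Monotone L
  pos : ∀ i, 0 < L i
  eq : A = S⁻¹ * Matrix.diagonal L * S

/-- The coordinate projection `R̂_Λ`, the sum of the elementary matrices `E_{ii}` with `L i = Λ`. -/
def projHat {n : ℕ} (L : Fin n → ℝ) (Λ : ℝ) : Matrix (Fin n) (Fin n) ℝ :=
  Matrix.diagonal fun i => if L i = Λ then 1 else 0

/-- The spectral projection `R_Λ = S⁻¹ R̂_Λ S` of `A = S⁻¹ diag[L] S`. -/
def proj {n : ℕ} (S : Matrix (Fin n) (Fin n) ℝ) (L : Fin n → ℝ) (Λ : ℝ) :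
    Matrix (Fin n) (Fin n) ℝ :=
  S⁻¹ * projHat L Λ * S

/-- `ṽ(t) = S y(t) / |S y(t)|`. -/
def vTilde {n : ℕ} (S : Matrix (Fin n) (Fin n) ℝ) (y : ℝ → EuclideanSpace ℝ (Fin n)) (t : ℝ) :
    EuclideanSpace ℝ (Fin n) :=
  ‖S.toEuclideanLin (y t)‖⁻¹ • S.toEuclideanLin (y t)

/-- `Ṽ₁(t) = |(Iₙ - R̂_Λ) ṽ(t)|`. -/
def V1Tilde {n : ℕ} (S : Matrix (Fin n) (Fin n) ℝ) (L : Fin n → ℝ) (Λ : ℝ)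
    (y : ℝ → EuclideanSpace ℝ (Fin n)) (t : ℝ) : ℝ :=
  ‖(1 - projHat L Λ).toEuclideanLin (vTilde S y t)‖

/-- `Ṽ₂(t) = |ṽ(t) - ṽ_*|`. -/
def V2Tilde {n : ℕ} (S : Matrix (Fin n) (Fin n) ℝ) (y : ℝ → EuclideanSpace ℝ (Fin n))
    (vs : EuclideanSpace ℝ (Fin n)) (t : ℝ) : ℝ :=
  ‖vTilde S y t - vs‖

/-- `Ẽ₀(t) = ‖S‖ ‖S⁻¹‖^(α+1) E₀(t)`. -/
def E0Tilde {n : ℕ} (S : Matrix (Fin n) (Fin n) ℝ) (α : ℝ) (E₀ : ℝ → ℝ) (t : ℝ) : ℝ :=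
  frobNorm S * frobNorm S⁻¹ ^ (α + 1) * E₀ t

/-- `Ẽ₁(t) = ∫_t^T Ẽ₀(τ) / (T - τ) dτ`. -/
def E1Tilde {n : ℕ} (S : Matrix (Fin n) (Fin n) ℝ) (α : ℝ) (E₀ : ℝ → ℝ) (T t : ℝ) : ℝ :=
  ∫ τ in t..T, E0Tilde S α E₀ τ / (T - τ)

/-- The pair `(Λ, ṽ_*)` that describes the asymptotic direction of `S y(t)` as `t → T⁻`:
`Λ` is an eigenvalue of `A`, `ṽ_*` is a unit vector, `Ṽ₁(t) → 0` and
`|R̂_Λ ṽ(t) - ṽ_*| = O(Ṽ₁(t) + Ẽ₁(t))`. -/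
structure IsAsymptoticDirection {n : ℕ} (A S : Matrix (Fin n) (Fin n) ℝ) (L : Fin n → ℝ)
    (α : ℝ) (E₀ : ℝ → ℝ) (T : ℝ) (y : ℝ → EuclideanSpace ℝ (Fin n))
    (Λ : ℝ) (vs : EuclideanSpace ℝ (Fin n)) : Prop where
  eigenvalue : Module.End.HasEigenvalue A.toEuclideanLin Λ
  unit : ‖vs‖ = 1
  tendsto_V1 : Tendsto (V1Tilde S L Λ y) (𝓝[<] T) (𝓝 0)
  isBigO : (fun t => (projHat L Λ).toEuclideanLin (vTilde S y t) - vs)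
    =O[𝓝[<] T] fun t => V1Tilde S L Λ y t + E1Tilde S α E₀ T t

/-- `ω`, considered on `[0, s₀]`, is a nonnegative nondecreasing function with
`lim_{s → 0} ω(s) = ω(0) = 0`, and it bounds the oscillation of `H` at the point `x₀`:
`|H(x) - H(x₀)| ≤ ω(|x - x₀|)` for all `x ≠ 0` with `|x - x₀| ≤ s₀`. -/
structure IsOscBound {n : ℕ} (H : EuclideanSpace ℝ (Fin n) → ℝ) (x₀ : EuclideanSpace ℝ (Fin n))
    (s₀ : ℝ) (ω : ℝ → ℝ) : Prop where
  s₀_pos : 0 < s₀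
  nonneg : ∀ s ∈ Icc 0 s₀, 0 ≤ ω s
  mono : MonotoneOn ω (Icc 0 s₀)
  zero : ω 0 = 0
  tendsto_zero : Tendsto ω (𝓝[Icc 0 s₀] 0) (𝓝 0)
  bound : ∀ x : EuclideanSpace ℝ (Fin n), x ≠ 0 → ‖x - x₀‖ ≤ s₀ → |H x - H x₀| ≤ ω ‖x - x₀‖

/-- `𝓔̃₀(t) = ω(‖S⁻¹‖ Ṽ₂(t)) + Ṽ₁(t) + Ẽ₀(t)`. -/
def calE0Tilde {n : ℕ} (S : Matrix (Fin n) (Fin n) ℝ) (L : Fin n → ℝ) (α : ℝ) (E₀ : ℝ → ℝ)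
    (y : ℝ → EuclideanSpace ℝ (Fin n)) (Λ : ℝ) (vs : EuclideanSpace ℝ (Fin n)) (ω : ℝ → ℝ)
    (t : ℝ) : ℝ :=
  ω (frobNorm S⁻¹ * V2Tilde S y vs t) + V1Tilde S L Λ y t + E0Tilde S α E₀ t

/-- `𝓔̃₁(t) = ∫_t^T 𝓔̃₀(τ) / (T - τ) dτ`. -/
def calE1Tilde {n : ℕ} (S : Matrix (Fin n) (Fin n) ℝ) (L : Fin n → ℝ) (α : ℝ) (E₀ : ℝ → ℝ)
    (T : ℝ) (y : ℝ → EuclideanSpace ℝ (Fin n)) (Λ : ℝ) (vs : EuclideanSpace ℝ (Fin n))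
    (ω : ℝ → ℝ) (t : ℝ) : ℝ :=
  ∫ τ in t..T, calE0Tilde S L α E₀ y Λ vs ω τ / (T - τ)

end BlowUp

end

/-! In the coordinates `z = S y` the equation becomes `z' = h(z) D z + g` with `D = diag[L]`
symmetric positive definite and `h(x) = H(S⁻¹ x)`. The size `|z|` and the direction `v = z / |z|`
are studied separately; write `λ = ⟨Dv, v⟩` and `R` for `R̂_Λ`.

Size: `|z|^(-α)` tends to `0` at `T` and has derivative `-α (h(v) λ + O(Ẽ₀))`. The factor `h(v) λ`
lies between positive constants, so `|z|^(-α)` is comparable to `T - t`, and `h(z)` to `1 / (T - t)`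
(`exists_norm_rpow_bounds`, `exists_speed_bounds`).

Direction: up to a change of time and a perturbation `O(Ẽ₀ / (T - t))`, `v` follows the gradient
flow of the Rayleigh quotient on the sphere, and `λ' = 2 h(z) |Dv - λv|² + O(Ẽ₀ / (T - t))`. As `λ`
is bounded, `|Dv - λv|² / (T - t)` is integrable and `λ` has a limit `Λ`
(`exists_tendsto_rayleigh`). The spectral gap passes integrability on to `|v - Rv|² / (T - t)`.
Since `|v - Rv|²` has a limit and `1 / (T - t)` is not integrable, that limit is `0`. On the range
of `R` the matrix `D` is the scalar `Λ`, so the direction of `Rz` is moved by the perturbation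
alone. It converges at rate `Ẽ₁`, and it differs from `Rv` by at most `|v - Rv|²`
(`exists_proj_dir_limit`).

Rates: integrating the inequality for `(|v - Rv|²)'` gives `Ṽ₁² = O(𝓔̃₁)`, which removes `Ṽ₁` from
the estimate of `Rv - ṽ_*` (`isBigO_proj`). The Rayleigh quotient differs from `Λ` only
quadratically in `v - Rv`, so `h(v) λ` is within `O(𝓔̃₀)` of `κ = Λ H(v_*)` (`exists_growth_bound`).
Integration gives `(T - t)^(1/α) |z| = (ακ)^(-1/α) + O(𝓔̃₁)` (`isBigO_norm`). Multiplying size by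
direction and applying `S⁻¹` yields the theorem. -/

namespace BlowUp

/-! ### Calculus of curves near a finite endpoint -/

section Calculus

variable {E : Type*} [NormedAddCommGroup E] [InnerProductSpace ℝ E]

theorem hasDerivAt_norm {x : ℝ → E} {x' : E} {t : ℝ} (hx : HasDerivAt x x' t) (h0 : x t ≠ 0) :
    HasDerivAt (fun s => ‖x s‖) (inner ℝ (x t) x' / ‖x t‖) t := by
  have h0' : ‖x t‖ ≠ 0 := norm_ne_zero_iff.2 h0
  have h1 : HasDerivAt (fun s => ‖x s‖ ^ 2) (2 * inner ℝ (x t) x') t := hx.norm_sq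
  have h2 := h1.sqrt (pow_ne_zero 2 h0')
  have h3 : (fun s => √(‖x s‖ ^ 2)) = fun s => ‖x s‖ := by
    ext s; exact Real.sqrt_sq (norm_nonneg _)
  rw [h3, Real.sqrt_sq (norm_nonneg _)] at h2
  convert h2 using 1
  field_simp

/-- Differentiation of a direction: the radial part of the velocity drops out. -/
theorem hasDerivAt_normalize {x : ℝ → E} {x' : E} {t : ℝ} (hx : HasDerivAt x x' t)
    (h0 : x t ≠ 0) :
    HasDerivAt (fun s => ‖x s‖⁻¹ • x s)
      (‖x t‖⁻¹ • (x' - inner ℝ x' (‖x t‖⁻¹ • x t) • (‖x t‖⁻¹ • x t))) t := by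
  have h0' : ‖x t‖ ≠ 0 := norm_ne_zero_iff.2 h0
  have h := ((hasDerivAt_norm hx h0).inv h0').smul hx
  refine h.congr_deriv ?_
  simp only [Pi.inv_apply, real_inner_smul_right, smul_sub, smul_smul, real_inner_comm (x t) x']
  rw [sub_eq_add_neg, ← neg_smul]
  congr 2
  field_simp

variable [CompleteSpace E]

/-- A curve whose speed is dominated by an integrable function has bounded displacement. -/
theorem norm_sub_le_integral_of_hasDerivAt {F F' : ℝ → E} {G : ℝ → ℝ} {a T : ℝ} {l : E}
    (hG : IntegrableOn G (Ioo a T)) (hF : ∀ t ∈ Ioo a T, HasDerivAt F (F' t) t) {t : ℝ}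
    (ht : t ∈ Ioo a T) (hFG : ∀ s ∈ Ioo t T, ‖F' s‖ ≤ G s)
    (hl : Tendsto F (𝓝[<] T) (𝓝 l)) : ‖F t - l‖ ≤ ∫ s in t..T, G s := by
  have hsub : Ioo t T ⊆ Ioo a T := Ioo_subset_Ioo_left ht.1.le
  have hGt : IntegrableOn G (Ioo t T) := hG.mono_set hsub
  -- No regularity of `F'` is assumed; it is measurable because it agrees with `deriv F` on the
  -- interval.
  have hmeas : AEStronglyMeasurable F' (volume.restrict (Ioo t T)) := by
    refine (aestronglyMeasurable_deriv F _).congr ?_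
    filter_upwards [ae_restrict_mem measurableSet_Ioo] with s hs using (hF s (hsub hs)).deriv
  have hint : IntegrableOn F' (Ioo t T) := by
    refine Integrable.mono' hGt hmeas ?_
    filter_upwards [ae_restrict_mem measurableSet_Ioo] with s hs using hFG s hs
  have hint' : IntervalIntegrable F' volume t T :=
    (intervalIntegrable_iff_integrableOn_Ioo_of_le ht.2.le).2 hint
  have hGt' : IntervalIntegrable G volume t T :=
    (intervalIntegrable_iff_integrableOn_Ioo_of_le ht.2.le).2 hGt
  have key := intervalIntegral.integral_eq_sub_of_hasDerivAt_of_tendsto ht.2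
    (fun s hs => hF s (hsub hs)) hint'
    ((hF t ht).continuousAt.tendsto.mono_left nhdsWithin_le_nhds) hl
  rw [norm_sub_rev, ← key]
  rw [intervalIntegral.integral_of_le ht.2.le, intervalIntegral.integral_of_le ht.2.le,
    integral_Ioc_eq_integral_Ioo, integral_Ioc_eq_integral_Ioo]
  refine norm_integral_le_of_norm_le hGt ?_
  filter_upwards [ae_restrict_mem measurableSet_Ioo] with s hs using hFG s hs

/-- A curve whose speed is dominated by an integrable function has a limit at the endpoint. -/
theorem exists_tendsto_of_hasDerivAt {F F' : ℝ → E} {G : ℝ → ℝ} {a T : ℝ} (haT : a < T)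
    (hG : IntegrableOn G (Ioo a T)) (hF : ∀ t ∈ Ioo a T, HasDerivAt F (F' t) t)
    (hFG : ∀ s ∈ Ioo a T, ‖F' s‖ ≤ G s) : ∃ l, Tendsto F (𝓝[<] T) (𝓝 l) := by
  obtain ⟨c, hc⟩ := nonempty_Ioo.2 haT
  have hmeas : AEStronglyMeasurable F' (volume.restrict (Ioo a T)) := by
    refine (aestronglyMeasurable_deriv F _).congr ?_
    filter_upwards [ae_restrict_mem measurableSet_Ioo] with s hs using (hF s hs).deriv
  have hint : IntegrableOn F' (Ioo a T) := by
    refine Integrable.mono' hG hmeas ?_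
    filter_upwards [ae_restrict_mem measurableSet_Ioo] with s hs using hFG s hs
  have hint' : IntegrableOn F' (uIcc c T) := by
    rw [uIcc_of_le hc.2.le, integrableOn_Icc_iff_integrableOn_Ioo]
    exact hint.mono_set (Ioo_subset_Ioo_left hc.1.le)
  have hcont := intervalIntegral.continuousOn_primitive_interval hint' T right_mem_uIcc
  have hlim : Tendsto (fun s => ∫ r in c..s, F' r) (𝓝[<] T) (𝓝 (∫ r in c..T, F' r)) := by
    refine hcont.tendsto.mono_left ?_
    rw [uIcc_of_le hc.2.le, nhdsWithin_Icc_eq_nhdsLE hc.2]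
    exact nhdsWithin_mono _ Iio_subset_Iic_self
  refine ⟨F c + ∫ r in c..T, F' r, (hlim.const_add (F c)).congr' ?_⟩
  filter_upwards [Ioo_mem_nhdsLT hc.2] with s hs
  have hs' : uIcc c s ⊆ Ioo a T := by
    rw [uIcc_of_le hs.1.le]; exact Icc_subset_Ioo hc.1 hs.2
  rw [intervalIntegral.integral_eq_sub_of_hasDerivAt (fun r hr => hF r (hs' hr))
    ((hint.mono_set hs').intervalIntegrable)]
  abel

end Calculus

/-- If `F` is bounded and `F' ≥ p - G` with `p ≥ 0` and `G` integrable, then `p` is integrable. -/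
theorem integrableOn_of_le_deriv {F F' p G : ℝ → ℝ} {a T M : ℝ} {c : ℝ} (hc : c ∈ Ioo a T)
    (hG : IntegrableOn G (Ioo a T)) (hF : ∀ t ∈ Ioo a T, HasDerivAt F (F' t) t)
    (hp : ContinuousOn p (Ioo a T)) (hp0 : ∀ t ∈ Ioo a T, 0 ≤ p t)
    (hle : ∀ t ∈ Ioo a T, p t - G t ≤ F' t) (hM : ∀ t ∈ Ioo a T, |F t| ≤ M) :
    IntegrableOn p (Ioo c T) := by
  have hGc : IntegrableOn G (Icc c T) :=
    integrableOn_Icc_iff_integrableOn_Ioo (by finiteness) (by finiteness) |>.2 (hG.mono_set (Ioo_subset_Ioo_left hc.1.le))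
  rw [← integrableOn_Ioc_iff_integrableOn_Ioo]
  obtain ⟨u, -, hu, hut⟩ := exists_seq_strictMono_tendsto' hc.2
  have hsub : ∀ k, Icc c (u k) ⊆ Ioo a T := fun k => Icc_subset_Ioo hc.1 (hu k).2
  have hpi : ∀ k, IntegrableOn p (Icc c (u k)) := fun k =>
    (hp.mono (hsub k)).integrableOn_Icc
  refine integrableOn_Ioc_of_intervalIntegral_norm_bounded_right
    -- Integrating `p ≤ F' + G` over `[c, u k]` bounds the integral of `p` by `F (u k) - F c + ∫ G`,
    -- uniformly in `k`.
    (I := 2 * M + ∫ s in Icc c T, ‖G s‖) (b := u) (l := atTop)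
    (fun k => (hpi k).mono_set Ioc_subset_Icc_self) hut (Eventually.of_forall fun k => ?_)
  have hGk : IntegrableOn G (Icc c (u k)) := hGc.mono_set (Icc_subset_Icc_right (hu k).2.le)
  have h1 := intervalIntegral.integral_le_sub_of_hasDeriv_right_of_le (hu k).1.le
    (fun s hs => (hF s (hsub k hs)).continuousAt.continuousWithinAt)
    (fun s hs => (hF s (hsub k (Ioo_subset_Icc_self hs))).hasDerivWithinAt)
    ((hpi k).sub hGk) (fun s hs => hle s (hsub k (Ioo_subset_Icc_self hs)))
  have h2 : ∫ s in c..u k, (p - G) s = (∫ s in c..u k, p s) - ∫ s in c..u k, G s :=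
    intervalIntegral.integral_sub
      ((intervalIntegrable_iff_integrableOn_Icc_of_le (hu k).1.le).2 (hpi k))
      ((intervalIntegrable_iff_integrableOn_Icc_of_le (hu k).1.le).2 hGk)
  have h3 : ∫ s in c..u k, G s ≤ ∫ s in Icc c T, ‖G s‖ := by
    rw [intervalIntegral.integral_of_le (hu k).1.le]
    calc ∫ s in Ioc c (u k), G s ≤ ∫ s in Ioc c (u k), ‖G s‖ :=
          (Real.le_norm_self _).trans (norm_integral_le_integral_norm _)
      _ ≤ ∫ s in Icc c T, ‖G s‖ := by
          refine setIntegral_mono_set hGc.norm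
            (Eventually.of_forall fun s => norm_nonneg _) ?_
          exact (Ioc_subset_Icc_self.trans (Icc_subset_Icc_right (hu k).2.le)).eventuallyLE
  have h4 : ∫ s in Ioc c (u k), ‖p s‖ = ∫ s in c..u k, p s := by
    rw [intervalIntegral.integral_of_le (hu k).1.le]
    refine setIntegral_congr_fun measurableSet_Ioc fun s hs => ?_
    exact Real.norm_of_nonneg (hp0 s (hsub k (Ioc_subset_Icc_self hs)))
  have h5 := abs_le.1 (hM c hc)
  have h6 := abs_le.1 (hM (u k) (hsub k (right_mem_Icc.2 (hu k).1.le)))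
  rw [h4]
  change ∫ s in c..u k, (p - G) s ≤ _ at h1
  linarith

/-- The weight `(T - t)⁻¹` is not integrable at `T`. -/
theorem not_eventually_le_of_integrableOn_div {q : ℝ → ℝ} {a T δ : ℝ} (haT : a < T)
    (hq : IntegrableOn (fun t => q t / (T - t)) (Ioo a T)) (hδ : 0 < δ) :
    ¬ ∀ᶠ t in 𝓝[<] T, δ ≤ q t := by
  intro h
  obtain ⟨b, hb, hbT⟩ := (mem_nhdsLT_iff_exists_Ioo_subset' haT).1 h
  set c := max a b
  have hcT : c < T := max_lt haT hb
  have hi : IntegrableOn (fun t => (T - t)⁻¹) (Ioo c T) := by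
    have hq' := (hq.mono_set (Ioo_subset_Ioo_left (le_max_left a b))).const_mul δ⁻¹
    refine Integrable.mono' hq' ?_ ?_
    · exact (measurable_const.sub measurable_id).inv.aestronglyMeasurable
    · filter_upwards [ae_restrict_mem measurableSet_Ioo] with s hs
      have hs2 : 0 < T - s := sub_pos.2 hs.2
      have hqs : δ ≤ q s := hbT ⟨(le_max_right a b).trans_lt hs.1, hs.2⟩
      rw [Real.norm_of_nonneg (inv_nonneg.2 hs2.le), ← one_div, div_le_iff₀ hs2]
      field_simp
      exact hqs
  have hi2 : IntervalIntegrable (fun t => (t - T)⁻¹) volume c T := by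
    rw [intervalIntegrable_iff_integrableOn_Ioo_of_le hcT.le]
    refine hi.neg.congr (Eventually.of_forall fun t => ?_)
    simp only [Pi.neg_apply]
    rw [← inv_neg, neg_sub]
  rcases intervalIntegrable_sub_inv_iff.1 hi2 with h | h
  · exact hcT.ne h
  · exact h right_mem_uIcc

theorem tendsto_integral_left {G : ℝ → ℝ} {a T : ℝ} (haT : a < T)
    (hG : IntegrableOn G (Ioo a T)) :
    Tendsto (fun t => ∫ s in t..T, G s) (𝓝[<] T) (𝓝 0) := by
  have hG' : IntegrableOn G (uIcc a T) := by
    rwa [uIcc_of_le haT.le, integrableOn_Icc_iff_integrableOn_Ioo]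
  have h := (intervalIntegral.continuousOn_primitive_interval_left hG' T right_mem_uIcc).tendsto
  rw [intervalIntegral.integral_same] at h
  refine h.mono_left ?_
  rw [uIcc_of_le haT.le, nhdsWithin_Icc_eq_nhdsLE haT]
  exact nhdsWithin_mono _ Iio_subset_Iic_self

end BlowUp

namespace BlowUp

/-! ### Perturbed flows: size and direction -/

section Flow

variable {E : Type*} [NormedAddCommGroup E] [InnerProductSpace ℝ E]

/-- The direction `z(t) / |z(t)|` of a curve. -/
noncomputable def dir (z : ℝ → E) (t : ℝ) : E := ‖z t‖⁻¹ • z t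

/-- The curve `z` blows up at time `T` and solves `z' = h(z) D z + g`, where `h` is positively
homogeneous of degree `α`, `D` is symmetric and positive definite, and `|g| ≤ |z|^(1+α) e` with
`e(t) / (T - t)` integrable. -/
structure PerturbedFlow (D : E →L[ℝ] E) (h : E → ℝ) (α a T : ℝ) (z g : ℝ → E) (e : ℝ → ℝ) :
    Prop where
  α_pos : 0 < α
  lt : a < T
  ne_zero : ∀ t ∈ Ioo a T, z t ≠ 0
  tendsto_norm : Tendsto (fun t => ‖z t‖) (𝓝[<] T) atTop
  ode : ∀ t ∈ Ioo a T, HasDerivAt z (h (z t) • D (z t) + g t) t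
  norm_le : ∀ t ∈ Ioo a T, ‖g t‖ ≤ ‖z t‖ ^ (1 + α) * e t
  nonneg : ∀ t ∈ Ioo a T, 0 ≤ e t
  integrable : IntegrableOn (fun t => e t / (T - t)) (Ioo a T)
  homogeneous : ∀ x : E, x ≠ 0 → ∀ s : ℝ, 0 < s → h (s • x) = s ^ α * h x
  bounds : ∃ p₁ p₂ : ℝ, 0 < p₁ ∧ ∀ x : E, ‖x‖ = 1 → p₁ ≤ h x ∧ h x ≤ p₂
  symm : ∀ x y : E, inner ℝ (D x) y = inner ℝ x (D y)
  pos : ∃ m : ℝ, 0 < m ∧ ∀ x : E, m * ‖x‖ ^ 2 ≤ inner ℝ (D x) x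

/-- `R` is an orthogonal projection into the eigenspace of `D` for `Λ` that commutes with `D`. -/
structure IsSpectralProj (D R : E →L[ℝ] E) (Λ : ℝ) : Prop where
  symm : ∀ x y : E, inner ℝ (R x) y = inner ℝ x (R y)
  idem : ∀ x : E, R (R x) = R x
  left : ∀ x : E, D (R x) = Λ • R x
  right : ∀ x : E, R (D x) = Λ • R x

theorem norm_sub_inner_smul_le {w : E} (hw : ‖w‖ = 1) (x : E) :
    ‖x - inner ℝ x w • w‖ ≤ 2 * ‖x‖ := by
  have h1 := abs_real_inner_le_norm x w
  calc ‖x - inner ℝ x w • w‖ ≤ ‖x‖ + ‖inner ℝ x w • w‖ := norm_sub_le _ _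
    _ ≤ 2 * ‖x‖ := by
      rw [norm_smul, hw, Real.norm_eq_abs]
      rw [hw] at h1
      linarith

/-- A radial velocity does not contribute to the motion of the direction. -/
theorem smul_add_sub_inner_smul {w : E} (hw : ‖w‖ = 1) (c : ℝ) (x : E) :
    c • w + x - inner ℝ (c • w + x) w • w = x - inner ℝ x w • w := by
  rw [inner_add_left, real_inner_smul_left, real_inner_self_eq_norm_sq, hw, add_smul]
  norm_num

namespace IsSpectralProj

variable {D R : E →L[ℝ] E} {Λ : ℝ}

theorem norm_sq_add (hR : IsSpectralProj D R Λ) (x : E) :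
    ‖R x‖ ^ 2 + ‖x - R x‖ ^ 2 = ‖x‖ ^ 2 := by
  have h : inner ℝ x (R x) = ‖R x‖ ^ 2 := by
    rw [← real_inner_self_eq_norm_sq, hR.symm, hR.idem]
  rw [norm_sub_sq_real, h]; ring

theorem norm_le (hR : IsSpectralProj D R Λ) (x : E) : ‖R x‖ ≤ ‖x‖ := by
  have h := hR.norm_sq_add x
  refine le_of_sq_le_sq ?_ (norm_nonneg _)
  nlinarith [sq_nonneg ‖x - R x‖]

theorem norm_sub_le (hR : IsSpectralProj D R Λ) (x : E) : ‖x - R x‖ ≤ ‖x‖ := by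
  have h := hR.norm_sq_add x
  refine le_of_sq_le_sq ?_ (norm_nonneg _)
  nlinarith [sq_nonneg ‖R x‖]

theorem inner_sub_eq (hR : IsSpectralProj D R Λ) (x y : E) :
    inner ℝ (x - R x) (y - R y) = inner ℝ (x - R x) y := by
  have : inner ℝ (x - R x) (R y) = 0 := by
    rw [← hR.symm, map_sub, hR.idem, sub_self, inner_zero_left]
  rw [inner_sub_right, this, sub_zero]

/-- The Rayleigh quotient differs from `Λ` by a quadratic term in the complementary component. -/
theorem abs_inner_sub_le (hR : IsSpectralProj D R Λ) {x : E} (hx : ‖x‖ = 1) :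
    |inner ℝ (D x) x - Λ| ≤ (‖D‖ + |Λ|) * ‖x - R x‖ ^ 2 := by
  have h0 : D x - Λ • x = D (x - R x) - Λ • (x - R x) := by
    rw [map_sub, hR.left, smul_sub]; abel
  have h1 : R (D x - Λ • x) = 0 := by rw [map_sub, hR.right, map_smul, sub_self]
  -- `D x - Λ x` depends only on `x - R x` and is orthogonal to the range of `R`. Hence both factors
  -- of the inner product carry the complement, which makes the bound quadratic.
  have h2 : inner ℝ (D x) x - Λ = inner ℝ (x - R x) (D (x - R x) - Λ • (x - R x)) := by
    rw [← h0, ← hR.inner_sub_eq, h1, sub_zero, inner_sub_left, hR.symm, h1, inner_zero_right,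
      sub_zero, inner_sub_right, real_inner_smul_right, real_inner_self_eq_norm_sq, hx,
      real_inner_comm]
    ring
  rw [h2]
  calc _ ≤ ‖x - R x‖ * ‖D (x - R x) - Λ • (x - R x)‖ := abs_real_inner_le_norm _ _
    _ ≤ ‖x - R x‖ * (‖D‖ * ‖x - R x‖ + |Λ| * ‖x - R x‖) := by
      gcongr
      refine (_root_.norm_sub_le _ _).trans ?_
      rw [norm_smul, Real.norm_eq_abs]
      gcongr
      exact D.le_opNorm _
    _ = _ := by ring

end IsSpectralProj

namespace PerturbedFlow

variable {D R : E →L[ℝ] E} {h : E → ℝ} {α a T Λ : ℝ} {z g : ℝ → E} {e : ℝ → ℝ}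

theorem norm_pos (P : PerturbedFlow D h α a T z g e) {t : ℝ} (ht : t ∈ Ioo a T) : 0 < ‖z t‖ :=
  norm_pos_iff.2 (P.ne_zero t ht)

theorem norm_dir (P : PerturbedFlow D h α a T z g e) {t : ℝ} (ht : t ∈ Ioo a T) :
    ‖dir z t‖ = 1 := by
  rw [dir, norm_smul, norm_inv, norm_norm, inv_mul_cancel₀ (P.norm_pos ht).ne']

theorem norm_smul_dir (P : PerturbedFlow D h α a T z g e) {t : ℝ} (ht : t ∈ Ioo a T) :
    ‖z t‖ • dir z t = z t := by
  rw [dir, smul_smul, mul_inv_cancel₀ (P.norm_pos ht).ne', one_smul]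

theorem apply_eq (P : PerturbedFlow D h α a T z g e) {t : ℝ} (ht : t ∈ Ioo a T) :
    h (z t) = ‖z t‖ ^ α * h (dir z t) := by
  conv_lhs => rw [← P.norm_smul_dir ht]
  refine P.homogeneous _ ?_ _ (P.norm_pos ht)
  exact norm_ne_zero_iff.1 (by rw [P.norm_dir ht]; exact one_ne_zero)

/-- The exponent `-α` cancels the homogeneity of `h(z) D z`: the derivative depends on the direction
only, apart from the perturbation, and blow-up of `|z|` becomes convergence to `0`. -/
theorem hasDerivAt_norm_rpow (P : PerturbedFlow D h α a T z g e) {t : ℝ} (ht : t ∈ Ioo a T) :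
    HasDerivAt (fun s => ‖z s‖ ^ (-α))
      (-(α * (h (dir z t) * inner ℝ (D (dir z t)) (dir z t)
        + inner ℝ (g t) (dir z t) * ‖z t‖ ^ (-α - 1)))) t := by
  have hr := P.norm_pos ht
  have h1 := (hasDerivAt_norm (P.ode t ht) (P.ne_zero t ht)).rpow_const (p := -α) (Or.inl hr.ne')
  refine h1.congr_deriv ?_
  have h2 : inner ℝ (z t) (h (z t) • D (z t) + g t) / ‖z t‖
      = ‖z t‖ ^ (α + 1) * (h (dir z t) * inner ℝ (D (dir z t)) (dir z t))
        + inner ℝ (g t) (dir z t) := by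
    have h3 : inner ℝ (z t) (h (z t) • D (z t) + g t) / ‖z t‖
        = inner ℝ (h (z t) • D (z t) + g t) (dir z t) := by
      rw [dir, real_inner_smul_right, real_inner_comm]; ring
    rw [h3, inner_add_left, real_inner_smul_left, P.apply_eq ht, Real.rpow_add_one hr.ne']
    congr 1
    conv_lhs => rw [← P.norm_smul_dir ht]
    rw [map_smul, real_inner_smul_left, P.norm_smul_dir ht]
    ring
  have h4 : ‖z t‖ ^ (α + 1) * ‖z t‖ ^ (-α - 1) = 1 := by
    rw [← Real.rpow_add hr]; norm_num
  rw [h2]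
  linear_combination
    -α * (h (dir z t) * inner ℝ (D (dir z t)) (dir z t)) * h4

theorem abs_inner_mul_rpow_le (P : PerturbedFlow D h α a T z g e) {t : ℝ} (ht : t ∈ Ioo a T) :
    |inner ℝ (g t) (dir z t) * ‖z t‖ ^ (-α - 1)| ≤ e t := by
  have hr := P.norm_pos ht
  have h1 : |inner ℝ (g t) (dir z t)| ≤ ‖z t‖ ^ (1 + α) * e t := by
    refine (abs_real_inner_le_norm _ _).trans ?_
    rw [P.norm_dir ht, mul_one]
    exact P.norm_le t ht
  have h4 : ‖z t‖ ^ (1 + α) * ‖z t‖ ^ (-α - 1) = 1 := by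
    rw [← Real.rpow_add hr, show 1 + α + (-α - 1) = 0 by ring, Real.rpow_zero]
  have h5 : 0 < ‖z t‖ ^ (-α - 1) := Real.rpow_pos_of_pos hr _
  rw [abs_mul, abs_of_pos h5]
  calc _ ≤ ‖z t‖ ^ (1 + α) * e t * ‖z t‖ ^ (-α - 1) := by gcongr
    _ = e t := by linear_combination e t * h4

theorem tendsto_norm_rpow (P : PerturbedFlow D h α a T z g e) :
    Tendsto (fun t => ‖z t‖ ^ (-α)) (𝓝[<] T) (𝓝 0) :=
  (tendsto_rpow_neg_atTop P.α_pos).comp P.tendsto_norm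

/-- If the growth factor `h(v)⟨Dv, v⟩` is close to `κ`, then `|z|^(-α)` is close to
`ακ(T - t)`. -/
theorem abs_norm_rpow_sub_le (P : PerturbedFlow D h α a T z g e) {G : ℝ → ℝ} {κ b t : ℝ}
    (hab : a ≤ b) (ht : t ∈ Ioo b T) (hG : IntegrableOn G (Ioo b T))
    (hle : ∀ s ∈ Ioo t T,
      |h (dir z s) * inner ℝ (D (dir z s)) (dir z s) - κ| + e s ≤ G s) :
    |‖z t‖ ^ (-α) - α * κ * (T - t)| ≤ α * ∫ s in t..T, G s := by
  have hba : ∀ s ∈ Ioo b T, s ∈ Ioo a T := fun s hs => ⟨hab.trans_lt hs.1, hs.2⟩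
  have hderiv : ∀ s ∈ Ioo b T, HasDerivAt (fun s => ‖z s‖ ^ (-α) - α * κ * (T - s))
      (-(α * (h (dir z s) * inner ℝ (D (dir z s)) (dir z s)
        + inner ℝ (g s) (dir z s) * ‖z s‖ ^ (-α - 1))) - α * κ * (-1)) s := fun s hs =>
    (P.hasDerivAt_norm_rpow (hba s hs)).sub
      (((hasDerivAt_id s).const_sub T).const_mul (α * κ))
  have hlim : Tendsto (fun s => ‖z s‖ ^ (-α) - α * κ * (T - s)) (𝓝[<] T) (𝓝 0) := by
    have h1 : Tendsto (fun s : ℝ => α * κ * (T - s)) (𝓝[<] T) (𝓝 (α * κ * (T - T))) :=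
      ((continuous_const.sub continuous_id).const_mul (α * κ)).continuousAt.tendsto.mono_left
        nhdsWithin_le_nhds
    simpa using P.tendsto_norm_rpow.sub h1
  have key := norm_sub_le_integral_of_hasDerivAt (hG.const_mul α) hderiv ht ?_ hlim
  · rwa [sub_zero, Real.norm_eq_abs, intervalIntegral.integral_const_mul] at key
  · intro s hs
    have hsb : s ∈ Ioo b T := ⟨ht.1.trans hs.1, hs.2⟩
    have h1 := P.abs_inner_mul_rpow_le (hba s hsb)
    have h2 := hle s hs
    have h3 := abs_add_le (h (dir z s) * inner ℝ (D (dir z s)) (dir z s) - κ)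
      (inner ℝ (g s) (dir z s) * ‖z s‖ ^ (-α - 1))
    have h4 : -(α * (h (dir z s) * inner ℝ (D (dir z s)) (dir z s)
        + inner ℝ (g s) (dir z s) * ‖z s‖ ^ (-α - 1))) - α * κ * (-1)
        = -(α * (h (dir z s) * inner ℝ (D (dir z s)) (dir z s) - κ
          + inner ℝ (g s) (dir z s) * ‖z s‖ ^ (-α - 1))) := by ring
    rw [h4, norm_neg, norm_mul, Real.norm_of_nonneg P.α_pos.le, Real.norm_eq_abs]
    exact mul_le_mul_of_nonneg_left (by linarith) P.α_pos.le

/-- The growth factor is pinched between `p₁ m > 0` and `p₂ ‖D‖`, and near `T` the perturbation is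
too small to spoil the lower bound. -/
theorem exists_norm_rpow_bounds (P : PerturbedFlow D h α a T z g e) :
    ∃ c C b : ℝ, 0 < c ∧ 0 < C ∧ b ∈ Ioo a T ∧ ∀ t ∈ Ioo b T,
      c * (T - t) ≤ ‖z t‖ ^ (-α) ∧ ‖z t‖ ^ (-α) ≤ C * (T - t) := by
  obtain ⟨p₁, p₂, hp₁, hp⟩ := P.bounds
  obtain ⟨m, hm, hD⟩ := P.pos
  have hα := P.α_pos
  set P₁ := p₁ * m with hP₁
  set P₂ := p₂ * ‖D‖ with hP₂
  have hP₁pos : 0 < P₁ := mul_pos hp₁ hm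
  have hfac : ∀ t ∈ Ioo a T, P₁ ≤ h (dir z t) * inner ℝ (D (dir z t)) (dir z t) ∧
      h (dir z t) * inner ℝ (D (dir z t)) (dir z t) ≤ P₂ := by
    intro t ht
    have h1 := P.norm_dir ht
    obtain ⟨h2, h3⟩ := hp _ h1
    have h4 := hD (dir z t)
    have h5 : inner ℝ (D (dir z t)) (dir z t) ≤ ‖D‖ := by
      refine (real_inner_le_norm _ _).trans ?_
      have := D.le_opNorm (dir z t)
      rw [h1, mul_one] at this ⊢
      exact this
    rw [h1, one_pow, mul_one] at h4
    exact ⟨mul_le_mul h2 h4 hm.le (hp₁.le.trans h2),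
      mul_le_mul h3 h5 (hm.le.trans h4) ((hp₁.le.trans h2).trans h3)⟩
  have hE := tendsto_integral_left P.lt P.integrable
  have hev : ∀ᶠ t in 𝓝[<] T, ∫ s in t..T, e s / (T - s) < P₁ / 2 :=
    hE.eventually (gt_mem_nhds (by positivity))
  obtain ⟨b₀, hb₀, hb₀T⟩ := (mem_nhdsLT_iff_exists_Ioo_subset' P.lt).1 hev
  obtain ⟨b, hb⟩ := nonempty_Ioo.2 (max_lt P.lt hb₀)
  have hab : a < b := (le_max_left _ _).trans_lt hb.1
  have hP₂pos : 0 < P₂ := by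
    obtain ⟨t, ht⟩ := nonempty_Ioo.2 P.lt
    have := hfac t ht
    linarith
  refine ⟨α * P₁ / 2, α * (P₂ + P₁ / 2), b, by positivity, by positivity, ⟨hab, hb.2⟩, ?_⟩
  intro t ht
  have hta : t ∈ Ioo a T := ⟨hab.trans ht.1, ht.2⟩
  have hTt : 0 < T - t := sub_pos.2 ht.2
  have hEt : ∫ s in t..T, e s / (T - s) < P₁ / 2 :=
    hb₀T ⟨((le_max_right _ _).trans_lt hb.1).trans ht.1, ht.2⟩
  -- The growth factor in `[P₁, P₂]` is within `(P₂ - P₁) / 2` of the midpoint. Since `T - s ≤ T -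
  -- t`, `e s ≤ (T - t) e s / (T - s)`, and the tail integral is below `P₁ / 2`; this leaves `P₁ /
  -- 2` below and `P₂ + P₁ / 2` above.
  have key := P.abs_norm_rpow_sub_le (κ := (P₁ + P₂) / 2) le_rfl hta
    (G := fun s => (P₂ - P₁) / 2 + (T - t) * (e s / (T - s)))
    ((integrableOn_const (by simp)).add (P.integrable.const_mul _)) ?_
  · have hi : IntervalIntegrable (fun s => e s / (T - s)) volume t T :=
      (intervalIntegrable_iff_integrableOn_Ioo_of_le ht.2.le).2
        (P.integrable.mono_set (Ioo_subset_Ioo_left hta.1.le))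
    rw [intervalIntegral.integral_add (by simp) (hi.const_mul _),
      intervalIntegral.integral_const_mul, intervalIntegral.integral_const, smul_eq_mul] at key
    have h1 : (T - t) * (∫ s in t..T, e s / (T - s)) ≤ (T - t) * (P₁ / 2) := by gcongr
    have h2 := mul_le_mul_of_nonneg_left h1 hα.le
    rw [abs_le] at key
    constructor <;> nlinarith [key.1, key.2]
  · intro s hs
    have hsa : s ∈ Ioo a T := ⟨hta.1.trans hs.1, hs.2⟩
    obtain ⟨h1, h2⟩ := hfac s hsa
    have h3 : e s ≤ (T - t) * (e s / (T - s)) := by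
      have hTs : 0 < T - s := sub_pos.2 hs.2
      rw [mul_div_assoc', le_div_iff₀ hTs, mul_comm]
      exact mul_le_mul_of_nonneg_right (by linarith [hs.1]) (P.nonneg s hsa)
    refine add_le_add (abs_le.2 ⟨by linarith, by linarith⟩) h3

theorem exists_speed_bounds (P : PerturbedFlow D h α a T z g e) :
    ∃ c C b : ℝ, 0 < c ∧ 0 < C ∧ b ∈ Ioo a T ∧ ∀ t ∈ Ioo b T,
      c / (T - t) ≤ h (z t) ∧ h (z t) ≤ C / (T - t) ∧ ‖z t‖ ^ α ≤ C / (T - t) := by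
  obtain ⟨p₁, p₂, hp₁, hp⟩ := P.bounds
  obtain ⟨c, C, b, hc, hC, hb, hbd⟩ := P.exists_norm_rpow_bounds
  have hp₂ : 0 < p₂ := by
    obtain ⟨t, ht⟩ := nonempty_Ioo.2 P.lt
    have := hp _ (P.norm_dir ht)
    linarith
  -- The maximum with `1` lets one constant bound both `h(z)` and `|z|^α`.
  refine ⟨p₁ / C, max p₂ 1 / c, b, by positivity, by positivity, hb, fun t ht => ?_⟩
  have hta : t ∈ Ioo a T := ⟨hb.1.trans ht.1, ht.2⟩
  have hr := P.norm_pos hta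
  have hTt : 0 < T - t := sub_pos.2 ht.2
  have hrα : 0 < ‖z t‖ ^ α := Real.rpow_pos_of_pos hr _
  obtain ⟨h1, h2⟩ := hbd t ht
  rw [Real.rpow_neg hr.le] at h1 h2
  obtain ⟨h3, h4⟩ := hp _ (P.norm_dir hta)
  have h5 : ‖z t‖ ^ α ≤ (c * (T - t))⁻¹ := by
    rw [le_inv_comm₀ hrα (by positivity)]; exact h1
  have h6 : (C * (T - t))⁻¹ ≤ ‖z t‖ ^ α := by
    rw [inv_le_comm₀ (by positivity) hrα]; exact h2
  rw [P.apply_eq hta]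
  refine ⟨?_, ?_, ?_⟩
  · calc p₁ / C / (T - t) = (C * (T - t))⁻¹ * p₁ := by field_simp
      _ ≤ _ := by gcongr
  · calc _ ≤ (c * (T - t))⁻¹ * max p₂ 1 := by
          gcongr
          · exact hp₁.le.trans h3
          · exact h4.trans (le_max_left _ _)
      _ = _ := by field_simp
  · calc _ ≤ (c * (T - t))⁻¹ * 1 := by rw [mul_one]; exact h5
      _ ≤ (c * (T - t))⁻¹ * max p₂ 1 := by
          gcongr
          exact le_max_right _ _
      _ = _ := by field_simp

theorem norm_div_le (P : PerturbedFlow D h α a T z g e) {t : ℝ} (ht : t ∈ Ioo a T) :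
    ‖z t‖⁻¹ * ‖g t‖ ≤ ‖z t‖ ^ α * e t := by
  have hr := P.norm_pos ht
  have h1 := P.norm_le t ht
  rw [Real.rpow_add hr, Real.rpow_one] at h1
  rw [inv_mul_le_iff₀ hr, ← mul_assoc]
  exact h1

/-- The equation for the direction, with a perturbation dominated by `e(t) / (T - t)`. -/
theorem exists_direction_eq (P : PerturbedFlow D h α a T z g e) :
    ∃ (c C b : ℝ) (q : ℝ → E), 0 < c ∧ 0 < C ∧ b ∈ Ioo a T ∧ ∀ t ∈ Ioo b T,
      c / (T - t) ≤ h (z t) ∧ h (z t) ≤ C / (T - t) ∧ ‖q t‖ ≤ C * (e t / (T - t)) ∧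
      HasDerivAt (dir z)
        (h (z t) • (D (dir z t) - inner ℝ (D (dir z t)) (dir z t) • dir z t) + q t) t := by
  -- The perturbation `q` is the tangential part of `g`, divided by `|z|`; the factor `2` comes from
  -- `norm_sub_inner_smul_le`.
  obtain ⟨c, C, b, hc, hC, hb, hbd⟩ := P.exists_speed_bounds
  refine ⟨c, 2 * C, b, fun t => ‖z t‖⁻¹ • (g t - inner ℝ (g t) (dir z t) • dir z t), hc,
    by positivity, hb, fun t ht => ?_⟩
  have hta : t ∈ Ioo a T := ⟨hb.1.trans ht.1, ht.2⟩
  have hr := P.norm_pos hta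
  have hTt : 0 < T - t := sub_pos.2 ht.2
  have he := P.nonneg t hta
  obtain ⟨h1, h2, h3⟩ := hbd t ht
  refine ⟨h1, h2.trans ?_, ?_, ?_⟩
  · gcongr; linarith
  · rw [norm_smul, norm_inv, norm_norm]
    calc _ ≤ ‖z t‖⁻¹ * (2 * ‖g t‖) := by
          gcongr; exact norm_sub_inner_smul_le (P.norm_dir hta) _
      _ = 2 * (‖z t‖⁻¹ * ‖g t‖) := by ring
      _ ≤ 2 * (C / (T - t) * e t) :=
          mul_le_mul_of_nonneg_left
            ((P.norm_div_le hta).trans (mul_le_mul_of_nonneg_right h3 he)) zero_le_two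
      _ = _ := by ring
  · refine (hasDerivAt_normalize (P.ode t hta) (P.ne_zero t hta)).congr_deriv ?_
    change ‖z t‖⁻¹ • (h (z t) • D (z t) + g t
      - inner ℝ (h (z t) • D (z t) + g t) (dir z t) • dir z t) = _
    have h4 : D (z t) = ‖z t‖ • D (dir z t) := by
      rw [← map_smul, P.norm_smul_dir hta]
    rw [h4, inner_add_left, real_inner_smul_left, real_inner_smul_left]
    simp only [smul_sub, smul_add, add_smul, smul_smul]
    have h5 : ‖z t‖⁻¹ * (h (z t) * ‖z t‖) = h (z t) := by field_simp
    have h6 : ‖z t‖⁻¹ * (h (z t) * (‖z t‖ * inner ℝ (D (dir z t)) (dir z t)))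
        = h (z t) * inner ℝ (D (dir z t)) (dir z t) := by field_simp
    rw [h5, h6]
    abel

theorem continuousOn_dir (P : PerturbedFlow D h α a T z g e) : ContinuousOn (dir z) (Ioo a T) :=
  fun t ht => (hasDerivAt_normalize (P.ode t ht) (P.ne_zero t ht)).continuousAt.continuousWithinAt

/-- The Rayleigh quotient of the direction converges, and the direction is nearly an eigenvector
in the mean. -/
theorem exists_tendsto_rayleigh (P : PerturbedFlow D h α a T z g e) :
    ∃ b ∈ Ioo a T, ∃ Λ : ℝ,
      Tendsto (fun t => inner ℝ (D (dir z t)) (dir z t)) (𝓝[<] T) (𝓝 Λ) ∧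
      IntegrableOn (fun t =>
        ‖D (dir z t) - inner ℝ (D (dir z t)) (dir z t) • dir z t‖ ^ 2 / (T - t)) (Ioo b T) := by
  obtain ⟨c, C, b, q, hc, hC, hb, hbd⟩ := P.exists_direction_eq
  have hsub : Ioo b T ⊆ Ioo a T := Ioo_subset_Ioo_left hb.1.le
  set lam : ℝ → ℝ := fun t => inner ℝ (D (dir z t)) (dir z t) with hlam
  set N : ℝ → ℝ := fun t => ‖D (dir z t) - lam t • dir z t‖ ^ 2 with hN
  have hder : ∀ t ∈ Ioo b T,
      HasDerivAt lam (2 * h (z t) * N t + 2 * inner ℝ (D (dir z t)) (q t)) t := by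
    intro t ht
    obtain ⟨-, -, -, hd⟩ := hbd t ht
    have h1 := (D.hasFDerivAt.comp_hasDerivAt t hd).inner ℝ hd
    refine h1.congr_deriv ?_
    have hv := P.norm_dir (hsub ht)
    -- Pythagoras: `lam t • v` is the orthogonal projection of `D v` onto the unit vector `v`.
    have hNt : N t = ‖D (dir z t)‖ ^ 2 - lam t ^ 2 := by
      simp only [hN]
      rw [norm_sub_sq_real, real_inner_smul_right, norm_smul, hv, mul_one, Real.norm_eq_abs,
        sq_abs]
      simp only [hlam]; ring
    rw [hNt]
    change inner ℝ (D (dir z t)) (h (z t) • (D (dir z t) - lam t • dir z t) + q t)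
      + inner ℝ (D (h (z t) • (D (dir z t) - lam t • dir z t) + q t)) (dir z t) = _
    rw [P.symm (_ + _), real_inner_comm (D (dir z t)), inner_add_right, real_inner_smul_right,
      inner_sub_right, real_inner_smul_right, real_inner_self_eq_norm_sq]
    change h (z t) * (‖D (dir z t)‖ ^ 2 - lam t * lam t) + _
      + (h (z t) * (‖D (dir z t)‖ ^ 2 - lam t * lam t) + _) = _
    ring
  have hDv : ∀ t ∈ Ioo b T, ‖D (dir z t)‖ ≤ ‖D‖ := fun t ht => by
    simpa [P.norm_dir (hsub ht)] using D.le_opNorm (dir z t)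
  set G : ℝ → ℝ := fun t => 2 * ‖D‖ * C * (e t / (T - t)) with hGdef
  have hG : IntegrableOn G (Ioo b T) := (P.integrable.mono_set hsub).const_mul _
  have hpert : ∀ t ∈ Ioo b T, |2 * inner ℝ (D (dir z t)) (q t)| ≤ G t := by
    intro t ht
    obtain ⟨-, -, hq, -⟩ := hbd t ht
    rw [abs_mul, abs_two]
    calc 2 * |inner ℝ (D (dir z t)) (q t)| ≤ 2 * (‖D (dir z t)‖ * ‖q t‖) := by
          gcongr; exact abs_real_inner_le_norm _ _
      _ ≤ 2 * (‖D‖ * (C * (e t / (T - t)))) := by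
          gcongr; exact hDv t ht
      _ = G t := by simp only [hGdef]; ring
  have hcont : ContinuousOn (dir z) (Ioo b T) := P.continuousOn_dir.mono hsub
  have hlamc : ContinuousOn lam (Ioo b T) := (D.continuous.comp_continuousOn hcont).inner hcont
  have hpc : ContinuousOn (fun t => N t / (T - t)) (Ioo b T) := by
    refine ContinuousOn.div ?_ (continuous_const.sub continuous_id).continuousOn
      fun t ht => (sub_pos.2 ht.2).ne'
    exact ((((D.continuous.comp_continuousOn hcont).sub (hlamc.smul hcont))).norm).pow 2
  have hN0 : ∀ t, 0 ≤ N t := fun t => by simp only [hN]; positivity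
  obtain ⟨b', hb'⟩ := nonempty_Ioo.2 hb.2
  -- The Rayleigh quotient is bounded by `‖D‖` and increases up to an integrable error, so its
  -- dissipation is integrable.
  have hint : IntegrableOn (fun t => 2 * c * (N t / (T - t))) (Ioo b' T) := by
    refine integrableOn_of_le_deriv (M := ‖D‖) hb' hG hder (hpc.const_mul _) ?_ ?_ ?_
      (p := fun t => 2 * c * (N t / (T - t)))
    · intro t ht
      have hTt : 0 < T - t := sub_pos.2 ht.2
      have := hN0 t
      positivity
    · intro t ht
      have h1 := (abs_le.1 (hpert t ht)).1
      have h2 := mul_le_mul_of_nonneg_right (hbd t ht).1 (hN0 t)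
      have h3 : c / (T - t) * N t = c * (N t / (T - t)) := by ring
      linarith
    · intro t ht
      refine (abs_real_inner_le_norm _ _).trans ?_
      rw [P.norm_dir (hsub ht), mul_one]
      exact hDv t ht
  have hint' : IntegrableOn (fun t => N t / (T - t)) (Ioo b' T) := by
    have := hint.const_mul (2 * c)⁻¹
    refine this.congr (Eventually.of_forall fun t => ?_)
    dsimp only
    field_simp
  have hsub' : Ioo b' T ⊆ Ioo b T := Ioo_subset_Ioo_left hb'.1.le
  -- With the dissipation known to be integrable, the upper speed bound makes the whole derivative
  -- of `lam` integrable, hence `lam` converges.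
  have hspeed : ∀ t ∈ Ioo b' T, ‖2 * h (z t) * N t + 2 * inner ℝ (D (dir z t)) (q t)‖
      ≤ 2 * C * (N t / (T - t)) + G t := by
    intro t ht
    have ht' := hsub' ht
    have hTt : 0 < T - t := sub_pos.2 ht.2
    obtain ⟨h1, h2, -, -⟩ := hbd t ht'
    have h0 : 0 ≤ h (z t) := le_trans (by positivity) h1
    refine (norm_add_le _ _).trans (add_le_add ?_ (hpert t ht'))
    rw [Real.norm_of_nonneg (by have := hN0 t; positivity)]
    calc 2 * h (z t) * N t ≤ 2 * (C / (T - t)) * N t := by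
          gcongr
      _ = _ := by ring
  obtain ⟨Λ, hΛ⟩ := exists_tendsto_of_hasDerivAt hb'.2
    ((hint'.const_mul _).add (hG.mono_set hsub')) (fun t ht => hder t (hsub' ht)) hspeed
  exact ⟨b', ⟨hb.1.trans hb'.1, hb'.2⟩, Λ, hΛ, hint'⟩

/-- Differential inequality for the component of the direction off the eigenspace. -/
theorem exists_deriv_compl (P : PerturbedFlow D h α a T z g e) (hR : IsSpectralProj D R Λ) :
    ∃ (C b : ℝ) (u' : ℝ → ℝ), 0 < C ∧ b ∈ Ioo a T ∧ ∀ t ∈ Ioo b T,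
      HasDerivAt (fun s => ‖dir z s - R (dir z s)‖ ^ 2) (u' t) t ∧
      |u' t| ≤ C * ((‖dir z t - R (dir z t)‖ ^ 2 + e t) / (T - t)) := by
  obtain ⟨c, C, b, q, hc, hC, hb, hbd⟩ := P.exists_direction_eq
  refine ⟨(4 * ‖D‖ + 2) * C, b, fun t => 2 * inner ℝ (dir z t - R (dir z t))
    (h (z t) • (D (dir z t) - inner ℝ (D (dir z t)) (dir z t) • dir z t) + q t), by positivity,
    hb, fun t ht => ?_⟩
  have hta : t ∈ Ioo a T := ⟨hb.1.trans ht.1, ht.2⟩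
  have hTt : 0 < T - t := sub_pos.2 ht.2
  have he := P.nonneg t hta
  have hv := P.norm_dir hta
  obtain ⟨h1, h2, hq, hd⟩ := hbd t ht
  have h0 : 0 ≤ h (z t) := le_trans (by positivity) h1
  constructor
  · have h3 := (hd.sub (R.hasFDerivAt.comp_hasDerivAt t hd)).norm_sq
    refine h3.congr_deriv ?_
    change 2 * inner ℝ (dir z t - R (dir z t)) (_ - R _) = _
    rw [hR.inner_sub_eq]
  · set x := dir z t with hx
    set lam := inner ℝ (D x) x with hlam
    have hlam' : |lam| ≤ ‖D‖ := by
      refine (abs_real_inner_le_norm _ _).trans ?_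
      rw [hv, mul_one]
      simpa [hv] using D.le_opNorm x
    -- `1 - R` commutes with `D`, so the drift is felt only through `x - R x` and contributes a
    -- quadratic term.
    have h4 : inner ℝ (x - R x) (D x - lam • x)
        = inner ℝ (x - R x) (D (x - R x) - lam • (x - R x)) := by
      rw [← hR.inner_sub_eq]
      congr 1
      rw [map_sub, map_sub, map_smul, hR.right, hR.left, smul_sub]
      abel
    have h5 : |inner ℝ (x - R x) (D x - lam • x)| ≤ 2 * ‖D‖ * ‖x - R x‖ ^ 2 := by
      rw [h4]
      calc _ ≤ ‖x - R x‖ * ‖D (x - R x) - lam • (x - R x)‖ := abs_real_inner_le_norm _ _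
        _ ≤ ‖x - R x‖ * (‖D‖ * ‖x - R x‖ + ‖D‖ * ‖x - R x‖) := by
          gcongr
          refine (norm_sub_le _ _).trans ?_
          rw [norm_smul, Real.norm_eq_abs]
          gcongr
          exact D.le_opNorm _
        _ = _ := by ring
    have h6 : |inner ℝ (x - R x) (q t)| ≤ C * (e t / (T - t)) := by
      calc _ ≤ ‖x - R x‖ * ‖q t‖ := abs_real_inner_le_norm _ _
        _ ≤ 1 * (C * (e t / (T - t))) := by
          gcongr
          exact (hR.norm_sub_le x).trans hv.le
        _ = _ := one_mul _
    change |2 * inner ℝ (x - R x) (h (z t) • (D x - lam • x) + q t)| ≤ _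
    rw [inner_add_right, real_inner_smul_right, abs_mul, abs_two]
    calc 2 * |h (z t) * inner ℝ (x - R x) (D x - lam • x) + inner ℝ (x - R x) (q t)|
        ≤ 2 * (h (z t) * |inner ℝ (x - R x) (D x - lam • x)| + |inner ℝ (x - R x) (q t)|) := by
          gcongr
          refine (abs_add_le _ _).trans ?_
          rw [abs_mul, abs_of_nonneg h0]
      _ ≤ 2 * (C / (T - t) * (2 * ‖D‖ * ‖x - R x‖ ^ 2) + C * (e t / (T - t))) := by gcongr
      _ = 4 * ‖D‖ * C * (‖x - R x‖ ^ 2 / (T - t)) + 2 * C * (e t / (T - t)) := by ring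
      _ ≤ (4 * ‖D‖ + 2) * C * (‖x - R x‖ ^ 2 / (T - t))
          + (4 * ‖D‖ + 2) * C * (e t / (T - t)) := by
          gcongr
          · linarith
          · linarith [norm_nonneg D]
      _ = _ := by ring

/-- The derivative is dominated by an integrable function, so a limit exists; a positive one would
make `1 / (T - t)` integrable near `T`. -/
theorem tendsto_compl_zero (P : PerturbedFlow D h α a T z g e) (hR : IsSpectralProj D R Λ)
    {b : ℝ} (hb : b ∈ Ioo a T)
    (hint : IntegrableOn (fun t => ‖dir z t - R (dir z t)‖ ^ 2 / (T - t)) (Ioo b T)) :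
    Tendsto (fun t => ‖dir z t - R (dir z t)‖ ^ 2) (𝓝[<] T) (𝓝 0) := by
  obtain ⟨C, b₁, u', hC, hb₁, hbd⟩ := P.exists_deriv_compl hR
  have hm : max b b₁ < T := max_lt hb.2 hb₁.2
  have hi : IntegrableOn (fun t => C * ((‖dir z t - R (dir z t)‖ ^ 2 + e t) / (T - t)))
      (Ioo (max b b₁) T) := by
    refine Integrable.const_mul ?_ C
    simp only [add_div]
    exact (hint.mono_set (Ioo_subset_Ioo_left (le_max_left _ _))).add
      (P.integrable.mono_set (Ioo_subset_Ioo_left (hb.1.le.trans (le_max_left _ _))))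
  have hsub : Ioo (max b b₁) T ⊆ Ioo b₁ T := Ioo_subset_Ioo_left (le_max_right _ _)
  obtain ⟨l, hl⟩ := exists_tendsto_of_hasDerivAt hm hi (fun t ht => (hbd t (hsub ht)).1)
    (fun t ht => (hbd t (hsub ht)).2)
  have hl0 : 0 ≤ l := ge_of_tendsto' hl fun t => by positivity
  rcases hl0.eq_or_lt with h0 | h0
  · rwa [← h0] at hl
  · exfalso
    refine not_eventually_le_of_integrableOn_div hb.2 hint (half_pos h0) ?_
    filter_upwards [hl.eventually (lt_mem_nhds (half_lt_self h0))] with t ht using ht.le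

/-- Integration of the differential inequality from `t` up to `T`, where the complement vanishes. It
trades the squared complement for a tail integral, as the sharp rate of the eigencomponent requires.
-/
theorem eventually_compl_le (P : PerturbedFlow D h α a T z g e) (hR : IsSpectralProj D R Λ)
    (hlim : Tendsto (fun t => ‖dir z t - R (dir z t)‖ ^ 2) (𝓝[<] T) (𝓝 0))
    {G : ℝ → ℝ} {b : ℝ} (hb : b < T) (hG : IntegrableOn (fun t => G t / (T - t)) (Ioo b T))
    (hle : ∀ t ∈ Ioo b T, ‖dir z t - R (dir z t)‖ ^ 2 + e t ≤ G t) :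
    ∃ C : ℝ, 0 < C ∧ ∀ᶠ t in 𝓝[<] T,
      ‖dir z t - R (dir z t)‖ ^ 2 ≤ C * ∫ s in t..T, G s / (T - s) := by
  obtain ⟨C, b₁, u', hC, hb₁, hbd⟩ := P.exists_deriv_compl hR
  refine ⟨C, hC, ?_⟩
  filter_upwards [Ioo_mem_nhdsLT (max_lt hb hb₁.2)] with t ht
  have hsub : Ioo (max b b₁) T ⊆ Ioo b₁ T := Ioo_subset_Ioo_left (le_max_right _ _)
  have hsub' : Ioo (max b b₁) T ⊆ Ioo b T := Ioo_subset_Ioo_left (le_max_left _ _)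
  have key := norm_sub_le_integral_of_hasDerivAt ((hG.mono_set hsub').const_mul C)
    (fun t ht => (hbd t (hsub ht)).1) ht ?_ hlim
  · rw [sub_zero, intervalIntegral.integral_const_mul, Real.norm_of_nonneg (by positivity)] at key
    exact key
  · intro s hs
    have hs' : s ∈ Ioo (max b b₁) T := ⟨ht.1.trans hs.1, hs.2⟩
    have hTs : 0 < T - s := sub_pos.2 hs.2
    refine (hbd s (hsub hs')).2.trans ?_
    gcongr
    exact hle s (hsub' hs')

/-- The eigencomponent of the direction converges to a unit vector. -/
theorem exists_proj_dir_limit [CompleteSpace E] (P : PerturbedFlow D h α a T z g e)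
    (hR : IsSpectralProj D R Λ)
    (hlim : Tendsto (fun t => ‖dir z t - R (dir z t)‖ ^ 2) (𝓝[<] T) (𝓝 0)) :
    ∃ (l : E) (C : ℝ), ‖l‖ = 1 ∧ 0 < C ∧ ∀ᶠ t in 𝓝[<] T, ‖R (dir z t) - l‖
      ≤ ‖dir z t - R (dir z t)‖ ^ 2 + C * ∫ s in t..T, e s / (T - s) := by
  obtain ⟨c, C, b, hc, hC, hb, hbd⟩ := P.exists_speed_bounds
  -- By Pythagoras the threshold `3 / 4` gives `|R v| ≥ 1 / 2`, so `R z` can be normalized.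
  have hev : ∀ᶠ t in 𝓝[<] T, ‖dir z t - R (dir z t)‖ ^ 2 < 3 / 4 :=
    hlim.eventually (gt_mem_nhds (by norm_num))
  obtain ⟨b₁, hb₁, hb₁T⟩ := (mem_nhdsLT_iff_exists_Ioo_subset' P.lt).1 hev
  set m := max b b₁
  have hm : m < T := max_lt hb.2 hb₁
  have hbm : ∀ t ∈ Ioo m T, t ∈ Ioo b T := fun t ht => ⟨(le_max_left _ _).trans_lt ht.1, ht.2⟩
  have ham : ∀ t ∈ Ioo m T, t ∈ Ioo a T := fun t ht => ⟨hb.1.trans (hbm t ht).1, ht.2⟩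
  have hRv : ∀ t ∈ Ioo m T, 1 / 2 ≤ ‖R (dir z t)‖ := by
    intro t ht
    have h1 : ‖dir z t - R (dir z t)‖ ^ 2 < 3 / 4 :=
      hb₁T ⟨(le_max_right _ _).trans_lt ht.1, ht.2⟩
    have h2 := hR.norm_sq_add (dir z t)
    rw [P.norm_dir (ham t ht)] at h2
    refine le_of_sq_le_sq ?_ (norm_nonneg _)
    linarith
  have hRz : ∀ t ∈ Ioo m T, R (z t) = ‖z t‖ • R (dir z t) := fun t ht => by
    rw [← map_smul, P.norm_smul_dir (ham t ht)]
  have hRz0 : ∀ t ∈ Ioo m T, ‖z t‖ / 2 ≤ ‖R (z t)‖ := fun t ht => by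
    rw [hRz t ht, norm_smul, norm_norm]
    have := mul_le_mul_of_nonneg_left (hRv t ht) (norm_nonneg (z t))
    linarith
  have hRzpos : ∀ t ∈ Ioo m T, 0 < ‖R (z t)‖ := fun t ht =>
    (half_pos (P.norm_pos (ham t ht))).trans_le (hRz0 t ht)
  set w : ℝ → E := fun t => ‖R (z t)‖⁻¹ • R (z t) with hw
  have hw1 : ∀ t ∈ Ioo m T, ‖w t‖ = 1 := fun t ht => by
    simp only [hw]
    rw [norm_smul, norm_inv, norm_norm, inv_mul_cancel₀ (hRzpos t ht).ne']
  have hder : ∀ t ∈ Ioo m T, HasDerivAt w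
      (‖R (z t)‖⁻¹ • (R (g t) - inner ℝ (R (g t)) (w t) • w t)) t := by
    intro t ht
    have h1 := R.hasFDerivAt.comp_hasDerivAt t (P.ode t (ham t ht))
    refine (hasDerivAt_normalize h1 (norm_pos_iff.1 (hRzpos t ht))).congr_deriv ?_
    change ‖R (z t)‖⁻¹ • (R (h (z t) • D (z t) + g t)
      - inner ℝ (R (h (z t) • D (z t) + g t)) (w t) • w t) = _
    -- As `R D = Λ R`, the unperturbed velocity of `R z` is radial and only `R g` turns `w`.
    have h2 : R (h (z t) • D (z t) + g t) = (h (z t) * Λ * ‖R (z t)‖) • w t + R (g t) := by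
      rw [map_add, map_smul, hR.right]
      simp only [hw, smul_smul]
      rw [mul_assoc (h (z t) * Λ), mul_inv_cancel₀ (hRzpos t ht).ne', mul_one]
    rw [h2, smul_add_sub_inner_smul (hw1 t ht)]
  have hbound : ∀ t ∈ Ioo m T, ‖‖R (z t)‖⁻¹ • (R (g t) - inner ℝ (R (g t)) (w t) • w t)‖
      ≤ 4 * C * (e t / (T - t)) := by
    intro t ht
    have hr := P.norm_pos (ham t ht)
    have h1 : ‖R (z t)‖⁻¹ ≤ 2 * ‖z t‖⁻¹ := by
      have := inv_anti₀ (half_pos hr) (hRz0 t ht)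
      rwa [inv_div, div_eq_mul_inv] at this
    have h2 := P.norm_div_le (ham t ht)
    have h3 := mul_le_mul_of_nonneg_right (hbd t (hbm t ht)).2.2 (P.nonneg t (ham t ht))
    rw [norm_smul, norm_inv, norm_norm]
    calc _ ≤ 2 * ‖z t‖⁻¹ * (2 * ‖g t‖) := by
          gcongr
          exact (norm_sub_inner_smul_le (hw1 t ht) _).trans (by gcongr; exact hR.norm_le _)
      _ = 4 * (‖z t‖⁻¹ * ‖g t‖) := by ring
      _ ≤ 4 * (C / (T - t) * e t) := mul_le_mul_of_nonneg_left (h2.trans h3) zero_le_four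
      _ = _ := by ring
  have hG : IntegrableOn (fun t => 4 * C * (e t / (T - t))) (Ioo m T) :=
    (P.integrable.mono_set (fun t ht => ham t ht)).const_mul _
  obtain ⟨l, hl⟩ := exists_tendsto_of_hasDerivAt hm hG hder hbound
  have hl1 : ‖l‖ = 1 := by
    refine tendsto_nhds_unique hl.norm (tendsto_const_nhds.congr' ?_)
    filter_upwards [Ioo_mem_nhdsLT hm] with t ht using (hw1 t ht).symm
  refine ⟨l, 4 * C, hl1, by positivity, ?_⟩
  filter_upwards [Ioo_mem_nhdsLT hm] with t ht
  have h1 := norm_sub_le_integral_of_hasDerivAt hG hder ht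
    (fun s hs => hbound s ⟨ht.1.trans hs.1, hs.2⟩) hl
  rw [intervalIntegral.integral_const_mul] at h1
  have h2 : R (dir z t) - w t = (‖R (dir z t)‖ - 1) • w t := by
    have hr := P.norm_pos (ham t ht)
    have hR0 : 0 < ‖R (dir z t)‖ := by linarith [hRv t ht]
    have h3 : w t = ‖R (dir z t)‖⁻¹ • R (dir z t) := by
      simp only [hw]
      rw [hRz t ht, norm_smul, norm_norm, smul_smul]
      congr 1
      field_simp
    rw [sub_smul, one_smul, h3, smul_smul, mul_inv_cancel₀ hR0.ne', one_smul]
  -- With `r = |R v| ∈ [0, 1]` the left side is `1 - r ≤ 1 - r² = |v - R v|²`.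
  have h4 : ‖R (dir z t) - w t‖ ≤ ‖dir z t - R (dir z t)‖ ^ 2 := by
    have h5 := hR.norm_sq_add (dir z t)
    have h6 := hR.norm_le (dir z t)
    rw [P.norm_dir (ham t ht)] at h5 h6
    rw [h2, norm_smul, hw1 t ht, mul_one, Real.norm_eq_abs, abs_of_nonpos (by linarith)]
    nlinarith [norm_nonneg (R (dir z t))]
  calc ‖R (dir z t) - l‖ = ‖(R (dir z t) - w t) + (w t - l)‖ := by rw [sub_add_sub_cancel]
    _ ≤ _ := (norm_add_le _ _).trans (add_le_add h4 h1)

end PerturbedFlow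

end Flow

end BlowUp

namespace BlowUp

/-! ### Rate of the size and selection of the eigenvalue -/

section Flow

variable {E : Type*} [NormedAddCommGroup E] [InnerProductSpace ℝ E]

theorem integral_div_nonneg {F : ℝ → ℝ} {b T t : ℝ} (ht : t ∈ Ioo b T)
    (hF : ∀ s ∈ Ioo b T, 0 ≤ F s) : 0 ≤ ∫ s in t..T, F s / (T - s) := by
  rw [intervalIntegral.integral_of_le ht.2.le, integral_Ioc_eq_integral_Ioo]
  refine setIntegral_nonneg measurableSet_Ioo fun s hs => ?_
  exact div_nonneg (hF s ⟨ht.1.trans hs.1, hs.2⟩) (sub_pos.2 hs.2).le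

theorem integral_div_mono {F G : ℝ → ℝ} {b T t : ℝ} (ht : t ∈ Ioo b T)
    (hF : IntegrableOn (fun s => F s / (T - s)) (Ioo b T))
    (hG : IntegrableOn (fun s => G s / (T - s)) (Ioo b T))
    (hFG : ∀ s ∈ Ioo b T, F s ≤ G s) :
    ∫ s in t..T, F s / (T - s) ≤ ∫ s in t..T, G s / (T - s) := by
  have hsub : Ioo t T ⊆ Ioo b T := Ioo_subset_Ioo_left ht.1.le
  rw [intervalIntegral.integral_of_le ht.2.le, integral_Ioc_eq_integral_Ioo,
    intervalIntegral.integral_of_le ht.2.le, integral_Ioc_eq_integral_Ioo]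
  refine setIntegral_mono_on (hF.mono_set hsub) (hG.mono_set hsub) measurableSet_Ioo
    fun s hs => ?_
  have hTs : 0 < T - s := sub_pos.2 hs.2
  have := hFG s (hsub hs)
  gcongr

namespace PerturbedFlow

variable {D R : E →L[ℝ] E} {h : E → ℝ} {α a T Λ : ℝ} {z g : ℝ → E} {e : ℝ → ℝ}

/-- The size of a solution whose growth factor converges to `κ` fast enough. -/
theorem isBigO_norm (P : PerturbedFlow D h α a T z g e) {F : ℝ → ℝ} {κ K b : ℝ} (hκ : 0 < κ)
    (hab : a ≤ b) (hbT : b < T) (hF : IntegrableOn (fun t => F t / (T - t)) (Ioo b T))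
    (hK : 0 ≤ K) (hF0 : ∀ t ∈ Ioo b T, 0 ≤ F t)
    (hle : ∀ s ∈ Ioo b T,
      |h (dir z s) * inner ℝ (D (dir z s)) (dir z s) - κ| + e s ≤ K * F s) :
    (fun t => (T - t) ^ (1 / α) * ‖z t‖ - (α * κ) ^ (-(1 / α)))
      =O[𝓝[<] T] fun t => ∫ s in t..T, F s / (T - s) := by
  have hα := P.α_pos
  have hακ : 0 < α * κ := mul_pos hα hκ
  have hlim := tendsto_integral_left hbT hF
  have h1 : (fun t => ‖z t‖ ^ (-α) / (T - t) - α * κ)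
      =O[𝓝[<] T] fun t => ∫ s in t..T, F s / (T - s) := by
    refine IsBigO.of_bound (α * K) ?_
    filter_upwards [Ioo_mem_nhdsLT hbT] with t ht
    have hTt : 0 < T - t := sub_pos.2 ht.2
    -- Since `T - s ≤ T - t`, `F s ≤ (T - t) F s / (T - s)`; the factor `T - t` then cancels on
    -- division.
    have key := P.abs_norm_rpow_sub_le (κ := κ) (G := fun s => K * (T - t) * (F s / (T - s))) hab
      ht (hF.const_mul _) ?_
    · rw [intervalIntegral.integral_const_mul] at key
      rw [Real.norm_of_nonneg (integral_div_nonneg ht hF0), Real.norm_eq_abs]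
      have h2 : ‖z t‖ ^ (-α) / (T - t) - α * κ
          = (‖z t‖ ^ (-α) - α * κ * (T - t)) / (T - t) := by field_simp
      rw [h2, abs_div, abs_of_pos hTt, div_le_iff₀ hTt]
      linarith
    · intro s hs
      have hs' : s ∈ Ioo b T := ⟨ht.1.trans hs.1, hs.2⟩
      have hTs : 0 < T - s := sub_pos.2 hs.2
      refine (hle s hs').trans ?_
      rw [mul_assoc]
      refine mul_le_mul_of_nonneg_left ?_ hK
      rw [mul_div_assoc', le_div_iff₀ hTs, mul_comm]
      exact mul_le_mul_of_nonneg_right (by linarith [hs.1]) (hF0 s hs')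
  have h2 : Tendsto (fun t => ‖z t‖ ^ (-α) / (T - t)) (𝓝[<] T) (𝓝 (α * κ)) := by
    have := (h1.trans_tendsto hlim).add_const (α * κ)
    simpa using this
  -- Differentiability of this power at `α κ > 0` carries the rate from `|z|^(-α) / (T - t)` over to
  -- `(T - t)^(1/α) |z|`.
  have h3 : (fun x : ℝ => x ^ (-(1 / α)) - (α * κ) ^ (-(1 / α))) =O[𝓝 (α * κ)]
      fun x => x - α * κ :=
    (Real.hasDerivAt_rpow_const (p := -(1 / α)) (Or.inl hακ.ne')).isBigO_sub
  refine ((h3.comp_tendsto h2).trans h1).congr' ?_ EventuallyEq.rfl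
  filter_upwards [Ioo_mem_nhdsLT hbT] with t ht
  have hTt : 0 < T - t := sub_pos.2 ht.2
  have hr := P.norm_pos (t := t) ⟨hab.trans_lt ht.1, ht.2⟩
  have h4 : (‖z t‖ ^ (-α) / (T - t)) ^ (-(1 / α)) = (T - t) ^ (1 / α) * ‖z t‖ := by
    rw [Real.div_rpow (Real.rpow_nonneg hr.le _) hTt.le, ← Real.rpow_mul hr.le,
      show -α * -(1 / α) = 1 by field_simp, Real.rpow_one, Real.rpow_neg hTt.le, div_inv_eq_mul,
      mul_comm]
  simp only [Function.comp_apply, h4]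

/-- If near-eigenvectors for `Λ` are close to the range of `R Λ`, for every `Λ`, then the direction
approaches one of these ranges. -/
theorem exists_tendsto_compl_zero (P : PerturbedFlow D h α a T z g e) {R : ℝ → E →L[ℝ] E}
    (hR : ∀ Λ, IsSpectralProj D (R Λ) Λ)
    (hgap : ∀ Λ, ∃ δ : ℝ, 0 < δ ∧
      ∀ lam : ℝ, |lam - Λ| < δ → ∀ x, δ * ‖x - R Λ x‖ ≤ ‖D x - lam • x‖) :
    ∃ Λ, Tendsto (fun t => ‖dir z t - R Λ (dir z t)‖ ^ 2) (𝓝[<] T) (𝓝 0) := by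
  obtain ⟨b, hb, Λ, hΛ, hint⟩ := P.exists_tendsto_rayleigh
  obtain ⟨δ, hδ, hgap⟩ := hgap Λ
  refine ⟨Λ, ?_⟩
  have hev : ∀ᶠ t in 𝓝[<] T, |inner ℝ (D (dir z t)) (dir z t) - Λ| < δ := by
    have := Metric.tendsto_nhds.1 hΛ δ hδ
    simpa [Real.dist_eq] using this
  obtain ⟨b₁, hb₁, hb₁T⟩ := (mem_nhdsLT_iff_exists_Ioo_subset' P.lt).1 hev
  have hm : max b b₁ ∈ Ioo a T := ⟨hb.1.trans_le (le_max_left _ _), max_lt hb.2 hb₁⟩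
  have hsub : Ioo (max b b₁) T ⊆ Ioo a T := Ioo_subset_Ioo_left hm.1.le
  refine P.tendsto_compl_zero (hR Λ) hm ?_
  -- Once the Rayleigh quotient is within `δ` of `Λ`, the gap bounds `|v - R v|²` by `δ⁻² |Dv -
  -- λv|²`.
  have hint' := (hint.mono_set (Ioo_subset_Ioo_left (le_max_left b b₁))).const_mul (δ ^ 2)⁻¹
  have hcont : ContinuousOn (dir z) (Ioo (max b b₁) T) := P.continuousOn_dir.mono hsub
  refine Integrable.mono' hint' ?_ ?_
  · refine ContinuousOn.aestronglyMeasurable ?_ measurableSet_Ioo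
    refine ContinuousOn.div ((hcont.sub ((R Λ).continuous.comp_continuousOn hcont)).norm.pow 2)
      (continuous_const.sub continuous_id).continuousOn fun t ht => (sub_pos.2 ht.2).ne'
  · filter_upwards [ae_restrict_mem measurableSet_Ioo] with t ht
    have hTt : 0 < T - t := sub_pos.2 ht.2
    have h1 := hgap _ (hb₁T ⟨(le_max_right b b₁).trans_lt ht.1, ht.2⟩) (dir z t)
    have h2 := pow_le_pow_left₀ (by positivity) h1 2
    rw [mul_pow] at h2
    rw [Real.norm_of_nonneg (by positivity), mul_div_assoc']
    gcongr
    rwa [le_inv_mul_iff₀ (by positivity)]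

end PerturbedFlow

end Flow

end BlowUp

namespace BlowUp

/-! ### Diagonalizing coordinates -/

section Coordinates

variable {n : ℕ}

theorem toEuclideanLin_mul_apply (M N : Matrix (Fin n) (Fin n) ℝ)
    (x : EuclideanSpace ℝ (Fin n)) :
    (M * N).toEuclideanLin x = M.toEuclideanLin (N.toEuclideanLin x) := by
  rw [Matrix.toEuclideanLin, Matrix.toLpLin_mul 2 2 2]; rfl

theorem toEuclideanLin_one_sub_apply (M : Matrix (Fin n) (Fin n) ℝ)
    (x : EuclideanSpace ℝ (Fin n)) :
    (1 - M).toEuclideanLin x = x - M.toEuclideanLin x := by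
  rw [map_sub, LinearMap.sub_apply, Matrix.toEuclideanLin, Matrix.toLpLin_one]; rfl

theorem toEuclideanLin_diagonal_apply (d : Fin n → ℝ) (x : EuclideanSpace ℝ (Fin n))
    (i : Fin n) : (Matrix.diagonal d).toEuclideanLin x i = d i * x i := by
  rw [Matrix.toLpLin_apply]
  exact Matrix.mulVec_diagonal d _ i

theorem frobNorm_nonneg (M : Matrix (Fin n) (Fin n) ℝ) : 0 ≤ frobNorm M := Real.sqrt_nonneg _

theorem norm_toEuclideanLin_le (M : Matrix (Fin n) (Fin n) ℝ) (x : EuclideanSpace ℝ (Fin n)) :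
    ‖M.toEuclideanLin x‖ ≤ frobNorm M * ‖x‖ := by
  refine le_of_sq_le_sq ?_ (mul_nonneg (frobNorm_nonneg _) (norm_nonneg _))
  rw [mul_pow, frobNorm, Real.sq_sqrt (by positivity), EuclideanSpace.norm_sq_eq,
    EuclideanSpace.norm_sq_eq, Finset.sum_mul]
  refine Finset.sum_le_sum fun i _ => ?_
  rw [Matrix.toLpLin_apply]
  simp only [Real.norm_eq_abs, sq_abs]
  exact Finset.sum_mul_sq_le_sq_mul_sq Finset.univ (M i) x.ofLp

/-- The continuous linear map of a matrix. -/
noncomputable def matCLM (M : Matrix (Fin n) (Fin n) ℝ) :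
    EuclideanSpace ℝ (Fin n) →L[ℝ] EuclideanSpace ℝ (Fin n) :=
  LinearMap.toContinuousLinearMap M.toEuclideanLin

theorem matCLM_apply (M : Matrix (Fin n) (Fin n) ℝ) (x : EuclideanSpace ℝ (Fin n)) :
    matCLM M x = M.toEuclideanLin x := rfl

theorem inner_diagonal_symm (d : Fin n → ℝ) (x y : EuclideanSpace ℝ (Fin n)) :
    inner ℝ (matCLM (Matrix.diagonal d) x) y = inner ℝ x (matCLM (Matrix.diagonal d) y) := by
  simp only [PiLp.inner_apply, matCLM_apply, toEuclideanLin_diagonal_apply]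
  refine Finset.sum_congr rfl fun i _ => ?_
  simp
  ring

theorem isSpectralProj_projHat (L : Fin n → ℝ) (Λ : ℝ) :
    IsSpectralProj (matCLM (Matrix.diagonal L)) (matCLM (projHat L Λ)) Λ where
  symm := inner_diagonal_symm _
  idem x := by
    ext i
    simp only [matCLM_apply, projHat, toEuclideanLin_diagonal_apply]
    split_ifs <;> simp
  left x := by
    ext i
    simp only [matCLM_apply, projHat, toEuclideanLin_diagonal_apply, PiLp.smul_apply, smul_eq_mul]
    split_ifs with h <;> simp [h]
  right x := by
    ext i
    simp only [matCLM_apply, projHat, toEuclideanLin_diagonal_apply, PiLp.smul_apply, smul_eq_mul]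
    split_ifs with h <;> simp [h]

theorem exists_spectral_gap (L : Fin n → ℝ) (Λ : ℝ) : ∃ δ : ℝ, 0 < δ ∧
    ∀ lam : ℝ, |lam - Λ| < δ → ∀ x : EuclideanSpace ℝ (Fin n),
      δ * ‖x - matCLM (projHat L Λ) x‖ ≤ ‖matCLM (Matrix.diagonal L) x - lam • x‖ := by
  -- The factor `2` keeps `|L i - lam| ≥ δ` for every `lam` within `δ` of `Λ`.
  have hev : ∀ᶠ δ : ℝ in 𝓝[>] 0, ∀ i, L i ≠ Λ → 2 * δ ≤ |L i - Λ| := by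
    rw [eventually_all]
    intro i
    by_cases hi : L i = Λ
    · simp [hi]
    · have hpos : 0 < |L i - Λ| / 2 := half_pos (abs_pos.2 (sub_ne_zero.2 hi))
      filter_upwards [Ioo_mem_nhdsGT hpos] with δ hδ _
      linarith [hδ.2]
  obtain ⟨δ, hgap, hδ⟩ := (hev.and self_mem_nhdsWithin).exists
  have hδ : 0 < δ := hδ
  refine ⟨δ, hδ, fun lam hlam x => ?_⟩
  refine le_of_sq_le_sq ?_ (norm_nonneg _)
  rw [mul_pow, EuclideanSpace.norm_sq_eq, EuclideanSpace.norm_sq_eq, Finset.mul_sum]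
  refine Finset.sum_le_sum fun i _ => ?_
  simp only [matCLM_apply, projHat, PiLp.sub_apply, toEuclideanLin_diagonal_apply, PiLp.smul_apply,
    smul_eq_mul, ← sub_mul, Real.norm_eq_abs, sq_abs]
  split_ifs with hi
  · rw [one_mul, sub_self, zero_pow two_ne_zero, mul_zero]
    exact sq_nonneg _
  · rw [zero_mul, sub_zero, mul_pow]
    refine mul_le_mul_of_nonneg_right ?_ (sq_nonneg _)
    have h1 := hgap i hi
    have h2 : δ ≤ |L i - lam| := by
      have := abs_sub_le (L i) lam Λ
      linarith
    rw [← sq_abs (L i - lam)]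
    exact pow_le_pow_left₀ hδ.le h2 2

variable {A S : Matrix (Fin n) (Fin n) ℝ} {L : Fin n → ℝ}

namespace IsPosDiagonalization

theorem inv_apply (hA : IsPosDiagonalization A S L) (x : EuclideanSpace ℝ (Fin n)) :
    S⁻¹.toEuclideanLin (S.toEuclideanLin x) = x := by
  rw [← toEuclideanLin_mul_apply, Matrix.nonsing_inv_mul _ hA.isUnit_det, Matrix.toEuclideanLin,
    Matrix.toLpLin_one]; rfl

theorem apply_inv (hA : IsPosDiagonalization A S L) (x : EuclideanSpace ℝ (Fin n)) :
    S.toEuclideanLin (S⁻¹.toEuclideanLin x) = x := by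
  rw [← toEuclideanLin_mul_apply, Matrix.mul_nonsing_inv _ hA.isUnit_det, Matrix.toEuclideanLin,
    Matrix.toLpLin_one]; rfl

theorem apply_eq (hA : IsPosDiagonalization A S L) (x : EuclideanSpace ℝ (Fin n)) :
    A.toEuclideanLin x
      = S⁻¹.toEuclideanLin ((Matrix.diagonal L).toEuclideanLin (S.toEuclideanLin x)) := by
  rw [hA.eq, toEuclideanLin_mul_apply, toEuclideanLin_mul_apply]

theorem conj_ne_zero (hA : IsPosDiagonalization A S L) {x : EuclideanSpace ℝ (Fin n)}
    (hx : x ≠ 0) : S.toEuclideanLin x ≠ 0 := fun h => hx <| by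
  rw [← hA.inv_apply x, h, map_zero]

theorem inv_ne_zero (hA : IsPosDiagonalization A S L) {x : EuclideanSpace ℝ (Fin n)}
    (hx : x ≠ 0) : S⁻¹.toEuclideanLin x ≠ 0 := fun h => hx <| by
  rw [← hA.apply_inv x, h, map_zero]

theorem hasEigenvector (hA : IsPosDiagonalization A S L) {x : EuclideanSpace ℝ (Fin n)}
    (hx : x ≠ 0) {Λ : ℝ} (h : (Matrix.diagonal L).toEuclideanLin x = Λ • x) :
    Module.End.HasEigenvector A.toEuclideanLin Λ (S⁻¹.toEuclideanLin x) := by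
  rw [Module.End.hasEigenvector_iff, Module.End.mem_eigenspace_iff]
  refine ⟨?_, hA.inv_ne_zero hx⟩
  rw [hA.apply_eq, hA.apply_inv, h, map_smul]

theorem exists_pos_inner (hA : IsPosDiagonalization A S L) :
    ∃ m : ℝ, 0 < m ∧ ∀ x, m * ‖x‖ ^ 2 ≤ inner ℝ (matCLM (Matrix.diagonal L) x) x := by
  have hev : ∀ᶠ m : ℝ in 𝓝[>] 0, ∀ i, m ≤ L i := by
    rw [eventually_all]
    intro i
    filter_upwards [Ioo_mem_nhdsGT (hA.pos i)] with m hm using hm.2.le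
  obtain ⟨m, hm, hm0⟩ := (hev.and self_mem_nhdsWithin).exists
  refine ⟨m, hm0, fun x => ?_⟩
  rw [EuclideanSpace.norm_sq_eq, Finset.mul_sum, PiLp.inner_apply]
  refine Finset.sum_le_sum fun i _ => ?_
  rw [matCLM_apply, toEuclideanLin_diagonal_apply, Real.norm_eq_abs, sq_abs]
  simp only [RCLike.inner_apply, conj_trivial]
  nlinarith [mul_le_mul_of_nonneg_right (hm i) (sq_nonneg (x i))]

end IsPosDiagonalization

/-- Compactness bounds `H` on the sphere; homogeneity extends this to `S⁻¹ x`, whose norm lies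
between `1 / ‖S‖` and `‖S⁻¹‖` for unit `x`. -/
theorem exists_bounds_conj (hA : IsPosDiagonalization A S L) {α : ℝ} (hα : 0 < α)
    {H : EuclideanSpace ℝ (Fin n) → ℝ} (hHhom : PosHomogeneous α H)
    (hHpos : ∀ x ∈ Metric.sphere (0 : EuclideanSpace ℝ (Fin n)) 1, 0 < H x)
    (hHcont : ContinuousOn H (Metric.sphere (0 : EuclideanSpace ℝ (Fin n)) 1)) :
    ∃ p₁ p₂ : ℝ, 0 < p₁ ∧ ∀ x, ‖x‖ = 1 →
      p₁ ≤ H (S⁻¹.toEuclideanLin x) ∧ H (S⁻¹.toEuclideanLin x) ≤ p₂ := by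
  -- The sphere is empty when `n = 0`.
  rcases (Metric.sphere (0 : EuclideanSpace ℝ (Fin n)) 1).eq_empty_or_nonempty with h0 | h0
  · refine ⟨1, 1, one_pos, fun x hx => ?_⟩
    have : x ∈ Metric.sphere (0 : EuclideanSpace ℝ (Fin n)) 1 := by simpa using hx
    simp [h0] at this
  have hcpt := isCompact_sphere (0 : EuclideanSpace ℝ (Fin n)) 1
  obtain ⟨x₁, hx₁, hmin⟩ := hcpt.exists_isMinOn h0 hHcont
  obtain ⟨x₂, hx₂, hmax⟩ := hcpt.exists_isMaxOn h0 hHcont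
  have hx₁1 : ‖x₁‖ = 1 := by simpa using hx₁
  have hfrob : 0 < frobNorm S := by
    have h1 := norm_toEuclideanLin_le S (S⁻¹.toEuclideanLin x₁)
    rw [hA.apply_inv, hx₁1] at h1
    refine (frobNorm_nonneg S).lt_of_ne fun h => ?_
    rw [← h, zero_mul] at h1
    linarith
  refine ⟨(frobNorm S)⁻¹ ^ α * H x₁, frobNorm S⁻¹ ^ α * H x₂,
    mul_pos (Real.rpow_pos_of_pos (inv_pos.2 hfrob) _) (hHpos _ hx₁), fun x hx => ?_⟩
  set w := S⁻¹.toEuclideanLin x with hw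
  have hw0 : w ≠ 0 := hA.inv_ne_zero (norm_ne_zero_iff.1 (by rw [hx]; exact one_ne_zero))
  have hwpos : 0 < ‖w‖ := norm_pos_iff.2 hw0
  have hu : ‖w‖⁻¹ • w ∈ Metric.sphere (0 : EuclideanSpace ℝ (Fin n)) 1 := by
    rw [mem_sphere_zero_iff_norm, norm_smul, norm_inv, norm_norm, inv_mul_cancel₀ hwpos.ne']
  have hHw : H w = ‖w‖ ^ α * H (‖w‖⁻¹ • w) := by
    rw [← hHhom _ (Metric.ne_of_mem_sphere hu one_ne_zero) _ hwpos, smul_smul,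
      mul_inv_cancel₀ hwpos.ne', one_smul]
  have hlow : (frobNorm S)⁻¹ ≤ ‖w‖ := by
    have h1 := norm_toEuclideanLin_le S w
    rw [hw, hA.apply_inv, hx, ← hw] at h1
    rwa [inv_le_iff_one_le_mul₀' hfrob]
  have hup : ‖w‖ ≤ frobNorm S⁻¹ := by
    have h1 := norm_toEuclideanLin_le S⁻¹ x
    rwa [hx, mul_one] at h1
  have h1 := hmin hu
  have h2 := hmax hu
  rw [mem_ofPred_eq] at h1 h2
  have h3 := hHpos _ hx₁
  have h4 := hHpos _ hx₂
  rw [hHw]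
  exact ⟨by gcongr, mul_le_mul (Real.rpow_le_rpow hwpos.le hup hα.le) h2 (h3.le.trans h1)
    (Real.rpow_nonneg (frobNorm_nonneg _) _)⟩

/-- The logarithm is at least `ln 2` once `T - s ≤ (T - t₀) / 2`; before that, `1 / (T - s)` is at
most `2 / (T - t₀)`. -/
theorem integrableOn_div_of_log {F : ℝ → ℝ} {t₀ T : ℝ} (hF0 : ∀ t ∈ Ico t₀ T, 0 ≤ F t)
    (hF : IntegrableOn F (Ico t₀ T))
    (hFlog : IntegrableOn (fun s => F s / (T - s) * Real.log ((T - t₀) / (T - s))) (Ico t₀ T)) :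
    IntegrableOn (fun s => F s / (T - s)) (Ico t₀ T) := by
  have hlog2 : 0 < Real.log 2 := Real.log_pos one_lt_two
  refine Integrable.mono' ((hF.const_mul (2 / (T - t₀))).add (hFlog.const_mul (Real.log 2)⁻¹)) ?_ ?_
  · exact hF.aestronglyMeasurable.mul
      (measurable_const.sub measurable_id).inv.aestronglyMeasurable
  · filter_upwards [ae_restrict_mem measurableSet_Ico] with s hs
    have hTs : 0 < T - s := sub_pos.2 hs.2
    have hT0 : 0 < T - t₀ := by linarith [hs.1]
    have h0 := hF0 s hs
    rw [Real.norm_of_nonneg (by positivity)]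
    have hl0 : 0 ≤ Real.log ((T - t₀) / (T - s)) :=
      Real.log_nonneg ((one_le_div hTs).2 (by linarith [hs.1]))
    simp only [Pi.add_apply]
    rcases le_total (T - t₀) (2 * (T - s)) with h | h
    · have h1 : F s / (T - s) ≤ 2 / (T - t₀) * F s := by
        rw [div_le_iff₀ hTs, div_mul_eq_mul_div, div_mul_eq_mul_div, le_div_iff₀ hT0]
        nlinarith
      have h2 : 0 ≤ (Real.log 2)⁻¹ * (F s / (T - s) * Real.log ((T - t₀) / (T - s))) := by
        positivity
      linarith
    · have h1 : Real.log 2 ≤ Real.log ((T - t₀) / (T - s)) :=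
        Real.log_le_log two_pos ((le_div_iff₀ hTs).2 h)
      have h2 : F s / (T - s)
          ≤ (Real.log 2)⁻¹ * (F s / (T - s) * Real.log ((T - t₀) / (T - s))) := by
        rw [le_inv_mul_iff₀ hlog2, mul_comm]
        gcongr
      have h3 : 0 ≤ 2 / (T - t₀) * F s := by positivity
      linarith

theorem E0Tilde_nonneg (S : Matrix (Fin n) (Fin n) ℝ) (α : ℝ) {E₀ : ℝ → ℝ} {t : ℝ}
    (h : 0 ≤ E₀ t) : 0 ≤ E0Tilde S α E₀ t :=
  mul_nonneg (mul_nonneg (frobNorm_nonneg _) (Real.rpow_nonneg (frobNorm_nonneg _) _)) h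

/-- In the coordinates `z = S y` a blowing-up solution is a perturbed flow of `diag[L]`. -/
theorem perturbedFlow_conj (hA : IsPosDiagonalization A S L) {α : ℝ} (hα : 0 < α)
    {H : EuclideanSpace ℝ (Fin n) → ℝ} (hHhom : PosHomogeneous α H)
    (hHpos : ∀ x ∈ Metric.sphere (0 : EuclideanSpace ℝ (Fin n)) 1, 0 < H x)
    (hHcont : ContinuousOn H (Metric.sphere (0 : EuclideanSpace ℝ (Fin n)) 1))
    {t₀ T : ℝ} (hT : t₀ < T) {y f : ℝ → EuclideanSpace ℝ (Fin n)} {E₀ : ℝ → ℝ}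
    (hy0 : ∀ t ∈ Ico t₀ T, y t ≠ 0)
    (hblow : Tendsto (fun t => ‖y t‖) (𝓝[<] T) atTop)
    (hode : ∀ t ∈ Ioo t₀ T, HasDerivAt y (H (y t) • A.toEuclideanLin (y t) + f t) t)
    (hfE : ∀ t ∈ Ico t₀ T, ‖f t‖ ≤ ‖y t‖ ^ (1 + α) * E₀ t)
    (hE0 : ∀ t ∈ Ico t₀ T, 0 ≤ E₀ t)
    (hEint : IntegrableOn E₀ (Ico t₀ T))
    (hElog : IntegrableOn
      (fun s => E₀ s / (T - s) * Real.log ((T - t₀) / (T - s))) (Ico t₀ T)) :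
    PerturbedFlow (matCLM (Matrix.diagonal L)) (fun x => H (S⁻¹.toEuclideanLin x)) α t₀ T
      (fun t => S.toEuclideanLin (y t)) (fun t => S.toEuclideanLin (f t)) (E0Tilde S α E₀) where
  α_pos := hα
  lt := hT
  ne_zero t ht := hA.conj_ne_zero (hy0 t (Ioo_subset_Ico_self ht))
  tendsto_norm := by
    have h1 : ∀ t, ‖y t‖ ≤ (frobNorm S⁻¹ + 1) * ‖S.toEuclideanLin (y t)‖ := fun t => by
      have := norm_toEuclideanLin_le S⁻¹ (S.toEuclideanLin (y t))
      rw [hA.inv_apply] at this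
      linarith [norm_nonneg (S.toEuclideanLin (y t))]
    have hpos : 0 < frobNorm S⁻¹ + 1 := by linarith [frobNorm_nonneg S⁻¹]
    exact (tendsto_const_mul_atTop_of_pos hpos).1 (tendsto_atTop_mono h1 hblow)
  ode t ht := by
    have h1 := (matCLM S).hasFDerivAt.comp_hasDerivAt t (hode t ht)
    refine h1.congr_deriv ?_
    rw [hA.inv_apply, map_add, map_smul, matCLM_apply, matCLM_apply, matCLM_apply, hA.apply_eq,
      hA.apply_inv]
  norm_le t ht := by
    have ht' := Ioo_subset_Ico_self ht
    have h1 := norm_toEuclideanLin_le S⁻¹ (S.toEuclideanLin (y t))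
    rw [hA.inv_apply] at h1
    have h2 : ‖y t‖ ^ (1 + α)
        ≤ frobNorm S⁻¹ ^ (1 + α) * ‖S.toEuclideanLin (y t)‖ ^ (1 + α) := by
      rw [← Real.mul_rpow (frobNorm_nonneg _) (norm_nonneg _)]
      exact Real.rpow_le_rpow (norm_nonneg _) h1 (by linarith)
    calc _ ≤ frobNorm S * ‖f t‖ := norm_toEuclideanLin_le _ _
      _ ≤ frobNorm S *
          (frobNorm S⁻¹ ^ (1 + α) * ‖S.toEuclideanLin (y t)‖ ^ (1 + α) * E₀ t) :=
        mul_le_mul_of_nonneg_left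
          ((hfE t ht').trans (mul_le_mul_of_nonneg_right h2 (hE0 t ht'))) (frobNorm_nonneg _)
      _ = _ := by rw [E0Tilde, add_comm α 1]; ring
  nonneg t ht := E0Tilde_nonneg _ _ (hE0 t (Ioo_subset_Ico_self ht))
  integrable := by
    have h1 := (integrableOn_div_of_log hE0 hEint hElog).const_mul
      (frobNorm S * frobNorm S⁻¹ ^ (α + 1))
    refine IntegrableOn.mono_set ?_ Ioo_subset_Ico_self
    refine h1.congr (Eventually.of_forall fun t => ?_)
    simp only [E0Tilde]
    ring
  homogeneous x hx s hs := by
    rw [map_smul]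
    exact hHhom _ (hA.inv_ne_zero hx) s hs
  bounds := exists_bounds_conj hA hα hHhom hHpos hHcont
  symm := inner_diagonal_symm L
  pos := hA.exists_pos_inner

end Coordinates

end BlowUp

namespace BlowUp

/-! ### The asymptotic direction and its rates -/

section Asymptotics

variable {n : ℕ} {A S : Matrix (Fin n) (Fin n) ℝ} {L : Fin n → ℝ} {α t₀ T : ℝ}
  {h : EuclideanSpace ℝ (Fin n) → ℝ} {y g : ℝ → EuclideanSpace ℝ (Fin n)} {E₀ : ℝ → ℝ}

theorem V1Tilde_eq (S : Matrix (Fin n) (Fin n) ℝ) (L : Fin n → ℝ) (Λ : ℝ)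
    (y : ℝ → EuclideanSpace ℝ (Fin n)) (t : ℝ) :
    V1Tilde S L Λ y t = ‖dir (fun t => S.toEuclideanLin (y t)) t
      - matCLM (projHat L Λ) (dir (fun t => S.toEuclideanLin (y t)) t)‖ := by
  rw [V1Tilde, toEuclideanLin_one_sub_apply]; rfl

theorem V1Tilde_nonneg (S : Matrix (Fin n) (Fin n) ℝ) (L : Fin n → ℝ) (Λ : ℝ)
    (y : ℝ → EuclideanSpace ℝ (Fin n)) (t : ℝ) : 0 ≤ V1Tilde S L Λ y t := norm_nonneg _

theorem V1Tilde_le_one {D : EuclideanSpace ℝ (Fin n) →L[ℝ] EuclideanSpace ℝ (Fin n)} {e : ℝ → ℝ}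
    (P : PerturbedFlow D h α t₀ T (fun t => S.toEuclideanLin (y t)) g e) (Λ : ℝ) {t : ℝ}
    (ht : t ∈ Ioo t₀ T) : V1Tilde S L Λ y t ≤ 1 := by
  rw [V1Tilde_eq, ← P.norm_dir ht]
  exact (isSpectralProj_projHat L Λ).norm_sub_le _

theorem tendsto_V1Tilde_sq {Λ : ℝ} (hV : Tendsto (V1Tilde S L Λ y) (𝓝[<] T) (𝓝 0)) :
    Tendsto (fun t => ‖dir (fun t => S.toEuclideanLin (y t)) t
      - matCLM (projHat L Λ) (dir (fun t => S.toEuclideanLin (y t)) t)‖ ^ 2) (𝓝[<] T) (𝓝 0) := by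
  have := hV.pow 2
  simp only [V1Tilde_eq] at this
  simpa using this

theorem exists_isAsymptoticDirection (hA : IsPosDiagonalization A S L)
    (P : PerturbedFlow (matCLM (Matrix.diagonal L)) h α t₀ T (fun t => S.toEuclideanLin (y t)) g
      (E0Tilde S α E₀)) :
    ∃ Λ vs, IsAsymptoticDirection A S L α E₀ T y Λ vs := by
  obtain ⟨Λ, hΛ⟩ := P.exists_tendsto_compl_zero (R := fun Λ => matCLM (projHat L Λ))
    (isSpectralProj_projHat L) (exists_spectral_gap L)
  have hR := isSpectralProj_projHat L Λ
  obtain ⟨l, C, hl, hC, hev⟩ := P.exists_proj_dir_limit hR hΛ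
  have hV : Tendsto (V1Tilde S L Λ y) (𝓝[<] T) (𝓝 0) := by
    have h1 := hΛ.sqrt
    rw [Real.sqrt_zero] at h1
    refine h1.congr fun t => ?_
    rw [Real.sqrt_sq (norm_nonneg _), V1Tilde_eq]
  refine ⟨Λ, l, ?_, hl, hV, ?_⟩
  -- If `Λ` were not an entry of `L`, the projection would be zero and the complement of the unit
  -- direction could not tend to `0`.
  · obtain ⟨i, hi⟩ : ∃ i, L i = Λ := by
      by_contra! hne
      have h0 : ∀ x, matCLM (projHat L Λ) x = 0 := fun x => by
        ext i
        simp [matCLM_apply, projHat, toEuclideanLin_diagonal_apply, hne i]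
      have h1 : ∀ᶠ t in 𝓝[<] T, (1 : ℝ) = ‖dir (fun t => S.toEuclideanLin (y t)) t
          - matCLM (projHat L Λ) (dir (fun t => S.toEuclideanLin (y t)) t)‖ ^ 2 := by
        filter_upwards [Ioo_mem_nhdsLT P.lt] with t ht
        rw [h0, sub_zero, P.norm_dir ht, one_pow]
      exact one_ne_zero (tendsto_nhds_unique (tendsto_const_nhds.congr' h1) hΛ)
    refine Module.End.hasEigenvalue_of_hasEigenvector
      (hA.hasEigenvector (x := EuclideanSpace.single i 1) (by simp) ?_)
    ext j
    rw [toEuclideanLin_diagonal_apply, PiLp.smul_apply, smul_eq_mul]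
    by_cases hj : j = i
    · rw [hj, hi]
    · simp [hj]
  · refine IsBigO.of_bound (1 + C) ?_
    filter_upwards [hev, Ioo_mem_nhdsLT P.lt] with t ht ht'
    have h1 := V1Tilde_nonneg S L Λ y t
    have h2 := V1Tilde_le_one (L := L) P Λ ht'
    have h3 : 0 ≤ E1Tilde S α E₀ T t := integral_div_nonneg ht' P.nonneg
    rw [Real.norm_of_nonneg (by positivity)]
    rw [← V1Tilde_eq] at ht
    refine ht.trans ?_
    change V1Tilde S L Λ y t ^ 2 + C * E1Tilde S α E₀ T t ≤ _
    nlinarith [mul_nonneg hC.le h1]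

theorem IsAsymptoticDirection.tendsto_proj {Λ : ℝ} {vs : EuclideanSpace ℝ (Fin n)}
    (P : PerturbedFlow (matCLM (Matrix.diagonal L)) h α t₀ T (fun t => S.toEuclideanLin (y t)) g
      (E0Tilde S α E₀))
    (hd : IsAsymptoticDirection A S L α E₀ T y Λ vs) :
    Tendsto (fun t => matCLM (projHat L Λ) (dir (fun t => S.toEuclideanLin (y t)) t)) (𝓝[<] T)
      (𝓝 vs) := by
  have h1 : Tendsto (fun t => V1Tilde S L Λ y t + E1Tilde S α E₀ T t) (𝓝[<] T) (𝓝 0) := by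
    have h2 := hd.tendsto_V1.add (tendsto_integral_left P.lt P.integrable)
    rw [add_zero] at h2
    exact h2
  have h3 := (hd.isBigO.trans_tendsto h1).add_const vs
  simp only [sub_add_cancel, zero_add] at h3
  exact h3

/-- Coordinate projections for distinct `Λ` annihilate each other, so a unit vector cannot be close
to both ranges. With `Λ` fixed, `vs` is determined as the limit of the projected direction. -/
theorem IsAsymptoticDirection.unique {Λ Λ' : ℝ} {vs vs' : EuclideanSpace ℝ (Fin n)}
    (P : PerturbedFlow (matCLM (Matrix.diagonal L)) h α t₀ T (fun t => S.toEuclideanLin (y t)) g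
      (E0Tilde S α E₀))
    (hd : IsAsymptoticDirection A S L α E₀ T y Λ vs)
    (hd' : IsAsymptoticDirection A S L α E₀ T y Λ' vs') : Λ = Λ' ∧ vs = vs' := by
  have hΛ : Λ = Λ' := by
    by_contra hne
    have h1 : ∀ᶠ t in 𝓝[<] T, (1 : ℝ) ≤ V1Tilde S L Λ y t + V1Tilde S L Λ' y t := by
      filter_upwards [Ioo_mem_nhdsLT P.lt] with t ht
      set x := dir (fun t => S.toEuclideanLin (y t)) t with hx
      have h2 : matCLM (projHat L Λ) x = matCLM (projHat L Λ) (x - matCLM (projHat L Λ') x) := by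
        ext i
        simp only [matCLM_apply, projHat, toEuclideanLin_diagonal_apply, PiLp.sub_apply]
        split_ifs with h3 h4
        · exact absurd (h3.symm.trans h4) hne
        · simp
        · simp
        · simp
      have h3 : ‖matCLM (projHat L Λ) x‖ ≤ V1Tilde S L Λ' y t := by
        rw [h2, V1Tilde_eq]
        exact (isSpectralProj_projHat L Λ).norm_le _
      calc (1 : ℝ) = ‖(x - matCLM (projHat L Λ) x) + matCLM (projHat L Λ) x‖ := by
            rw [sub_add_cancel, hx, P.norm_dir ht]
        _ ≤ _ := (norm_add_le _ _).trans (add_le_add (V1Tilde_eq S L Λ y t).ge h3)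
    have h2 := hd.tendsto_V1.add hd'.tendsto_V1
    have h3 := ge_of_tendsto h2 h1
    norm_num at h3
  subst hΛ
  exact ⟨rfl, tendsto_nhds_unique (hd.tendsto_proj P) (hd'.tendsto_proj P)⟩

/-- Sharp estimate of the eigencomponent of the direction by the total error. -/
theorem IsAsymptoticDirection.isBigO_proj {Λ b : ℝ} {vs : EuclideanSpace ℝ (Fin n)} {F : ℝ → ℝ}
    (P : PerturbedFlow (matCLM (Matrix.diagonal L)) h α t₀ T (fun t => S.toEuclideanLin (y t)) g
      (E0Tilde S α E₀))
    (hd : IsAsymptoticDirection A S L α E₀ T y Λ vs) (hb : t₀ ≤ b) (hbT : b < T)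
    (hF : IntegrableOn (fun t => F t / (T - t)) (Ioo b T))
    (hle : ∀ t ∈ Ioo b T, V1Tilde S L Λ y t + E0Tilde S α E₀ t ≤ F t) :
    (fun t => matCLM (projHat L Λ) (dir (fun t => S.toEuclideanLin (y t)) t) - vs)
      =O[𝓝[<] T] fun t => ∫ s in t..T, F s / (T - s) := by
  have hR := isSpectralProj_projHat L Λ
  have hsub : Ioo b T ⊆ Ioo t₀ T := Ioo_subset_Ioo_left hb
  have hlim := tendsto_V1Tilde_sq hd.tendsto_V1
  have hle' : ∀ t ∈ Ioo b T, E0Tilde S α E₀ t ≤ F t := fun t ht =>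
    le_trans (le_add_of_nonneg_left (V1Tilde_nonneg S L Λ y t)) (hle t ht)
  obtain ⟨l, C, hl, hC, hev⟩ := P.exists_proj_dir_limit hR hlim
  -- `Ṽ₁ ≤ 1` gives `Ṽ₁² ≤ Ṽ₁`, so `F` dominates the right side of the differential inequality.
  obtain ⟨C', hC', hev'⟩ := P.eventually_compl_le hR hlim hbT hF fun t ht => by
    refine le_trans (add_le_add_left ?_ _) (hle t ht)
    rw [← V1Tilde_eq]
    have h1 := V1Tilde_nonneg S L Λ y t
    have h2 := V1Tilde_le_one (L := L) P Λ (hsub ht)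
    nlinarith
  have hbound : (fun t => matCLM (projHat L Λ) (dir (fun t => S.toEuclideanLin (y t)) t) - l)
      =O[𝓝[<] T] fun t => ∫ s in t..T, F s / (T - s) := by
    refine IsBigO.of_bound (C' + C) ?_
    filter_upwards [hev, hev', Ioo_mem_nhdsLT hbT] with t h1 h2 ht
    have h3 := integral_div_mono ht (P.integrable.mono_set hsub) hF hle'
    rw [Real.norm_of_nonneg (integral_div_nonneg ht
      fun s hs => (P.nonneg s (hsub hs)).trans (hle' s hs))]
    have h4 := mul_le_mul_of_nonneg_left h3 hC.le
    linarith
  -- The limit produced by the flow must be the given `vs`, since both are limits of the projected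
  -- direction.
  have hlvs : l = vs := by
    have h1 := (hbound.trans_tendsto (tendsto_integral_left hbT hF)).add_const l
    simp only [sub_add_cancel, zero_add] at h1
    exact tendsto_nhds_unique h1 (hd.tendsto_proj P)
  rwa [hlvs] at hbound

/-- `vs` is a limit of vectors fixed by the continuous idempotent `R̂_Λ`. -/
theorem IsAsymptoticDirection.proj_eq {Λ : ℝ} {vs : EuclideanSpace ℝ (Fin n)}
    (P : PerturbedFlow (matCLM (Matrix.diagonal L)) h α t₀ T (fun t => S.toEuclideanLin (y t)) g
      (E0Tilde S α E₀))
    (hd : IsAsymptoticDirection A S L α E₀ T y Λ vs) : matCLM (projHat L Λ) vs = vs := by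
  have h1 := hd.tendsto_proj P
  have h2 := ((matCLM (projHat L Λ)).continuous.tendsto vs).comp h1
  refine tendsto_nhds_unique h2 (h1.congr fun t => ?_)
  exact ((isSpectralProj_projHat L Λ).idem _).symm

theorem IsAsymptoticDirection.diagonal_apply {Λ : ℝ} {vs : EuclideanSpace ℝ (Fin n)}
    (P : PerturbedFlow (matCLM (Matrix.diagonal L)) h α t₀ T (fun t => S.toEuclideanLin (y t)) g
      (E0Tilde S α E₀))
    (hd : IsAsymptoticDirection A S L α E₀ T y Λ vs) :
    (Matrix.diagonal L).toEuclideanLin vs = Λ • vs := by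
  have h1 := (isSpectralProj_projHat L Λ).left vs
  rwa [hd.proj_eq P] at h1

theorem IsAsymptoticDirection.pos {Λ : ℝ} {vs : EuclideanSpace ℝ (Fin n)}
    (P : PerturbedFlow (matCLM (Matrix.diagonal L)) h α t₀ T (fun t => S.toEuclideanLin (y t)) g
      (E0Tilde S α E₀))
    (hd : IsAsymptoticDirection A S L α E₀ T y Λ vs) : 0 < Λ := by
  obtain ⟨m, hm, hpos⟩ := P.pos
  have h1 := hpos vs
  rw [matCLM_apply, hd.diagonal_apply P, real_inner_smul_left, real_inner_self_eq_norm_sq,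
    hd.unit] at h1
  linarith

theorem calE0Tilde_eq (S : Matrix (Fin n) (Fin n) ℝ) (L : Fin n → ℝ) (α : ℝ) (E₀ : ℝ → ℝ)
    (y : ℝ → EuclideanSpace ℝ (Fin n)) (Λ : ℝ) (vs : EuclideanSpace ℝ (Fin n)) (ω : ℝ → ℝ)
    (t : ℝ) : calE0Tilde S L α E₀ y Λ vs ω t =
      ω (frobNorm S⁻¹ * V2Tilde S y vs t) + V1Tilde S L Λ y t + E0Tilde S α E₀ t := rfl

/-- The growth factor along the solution differs from its limit by at most the total error. -/
theorem exists_growth_bound {H : EuclideanSpace ℝ (Fin n) → ℝ}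
    (hA : IsPosDiagonalization A S L)
    (P : PerturbedFlow (matCLM (Matrix.diagonal L)) (fun x => H (S⁻¹.toEuclideanLin x)) α t₀ T
      (fun t => S.toEuclideanLin (y t)) g (E0Tilde S α E₀))
    {Λ : ℝ} {vs : EuclideanSpace ℝ (Fin n)} {s₀ T₁ : ℝ} {ω : ℝ → ℝ}
    (hω : IsOscBound H (S⁻¹.toEuclideanLin vs) s₀ ω) (hT₁ : t₀ ≤ T₁)
    (hs₀ : ∀ t ∈ Ico T₁ T, frobNorm S⁻¹ * V2Tilde S y vs t ≤ s₀) :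
    ∃ K : ℝ, 0 ≤ K ∧ ∀ t ∈ Ioo T₁ T,
      |H (S⁻¹.toEuclideanLin (dir (fun t => S.toEuclideanLin (y t)) t)) *
        inner ℝ (matCLM (Matrix.diagonal L) (dir (fun t => S.toEuclideanLin (y t)) t))
          (dir (fun t => S.toEuclideanLin (y t)) t)
        - H (S⁻¹.toEuclideanLin vs) * Λ| + E0Tilde S α E₀ t
      ≤ K * calE0Tilde S L α E₀ y Λ vs ω t := by
  set D := matCLM (Matrix.diagonal L) with hD
  set Hs := H (S⁻¹.toEuclideanLin vs) with hHs
  refine ⟨‖D‖ + |Hs| * (‖D‖ + |Λ|) + 1, by positivity, fun t ht => ?_⟩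
  have hta : t ∈ Ioo t₀ T := ⟨hT₁.trans_lt ht.1, ht.2⟩
  have hR := isSpectralProj_projHat L Λ
  set x := dir (fun t => S.toEuclideanLin (y t)) t with hx
  have hx1 : ‖x‖ = 1 := P.norm_dir hta
  have hx0 : x ≠ 0 := norm_ne_zero_iff.1 (by rw [hx1]; exact one_ne_zero)
  set lam := inner ℝ (D x) x with hlam
  have hV2 := hs₀ t (Ioo_subset_Ico_self ht)
  have hV20 : 0 ≤ frobNorm S⁻¹ * V2Tilde S y vs t :=
    mul_nonneg (frobNorm_nonneg _) (norm_nonneg _)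
  have hdist : ‖S⁻¹.toEuclideanLin x - S⁻¹.toEuclideanLin vs‖ ≤ frobNorm S⁻¹ * V2Tilde S y vs t := by
    rw [← map_sub]
    exact norm_toEuclideanLin_le _ _
  have h1 : |H (S⁻¹.toEuclideanLin x) - Hs| ≤ ω (frobNorm S⁻¹ * V2Tilde S y vs t) :=
    (hω.bound _ (hA.inv_ne_zero hx0) (hdist.trans hV2)).trans
      (hω.mono ⟨norm_nonneg _, hdist.trans hV2⟩ ⟨hV20, hV2⟩ hdist)
  have hω0 := hω.nonneg _ ⟨hV20, hV2⟩
  have h2 : |lam| ≤ ‖D‖ := by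
    refine (abs_real_inner_le_norm _ _).trans ?_
    rw [hx1, mul_one]
    simpa [hx1] using D.le_opNorm x
  have hV0 := V1Tilde_nonneg S L Λ y t
  have hV1 := V1Tilde_le_one (L := L) P Λ hta
  have h3 : |lam - Λ| ≤ (‖D‖ + |Λ|) * V1Tilde S L Λ y t := by
    refine (hR.abs_inner_sub_le hx1).trans ?_
    rw [hx, ← V1Tilde_eq]
    refine mul_le_mul_of_nonneg_left ?_ (by positivity)
    nlinarith
  have h4 : |H (S⁻¹.toEuclideanLin x) * lam - Hs * Λ|
      ≤ ω (frobNorm S⁻¹ * V2Tilde S y vs t) * ‖D‖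
        + |Hs| * ((‖D‖ + |Λ|) * V1Tilde S L Λ y t) := by
    -- The first product is controlled by `ω` and `|lam| ≤ ‖D‖`, the second by the quadratic
    -- Rayleigh estimate; the extra `1` in `K` absorbs `Ẽ₀`.
    have h5 : H (S⁻¹.toEuclideanLin x) * lam - Hs * Λ
        = (H (S⁻¹.toEuclideanLin x) - Hs) * lam + Hs * (lam - Λ) := by ring
    rw [h5]
    refine (abs_add_le _ _).trans ?_
    rw [abs_mul, abs_mul]
    gcongr
  have he := P.nonneg t hta
  rw [calE0Tilde_eq]
  have hD0 := norm_nonneg D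
  have hK : 0 ≤ |Hs| * (‖D‖ + |Λ|) := by positivity
  nlinarith [mul_nonneg hK hω0, mul_nonneg hK he, mul_nonneg hD0 hV0, mul_nonneg hD0 he]

end Asymptotics

end BlowUp

/-! ### Assembly of size and direction -/

theorem mainTheorem5 {n : ℕ}
    (A S : Matrix (Fin n) (Fin n) ℝ) (L : Fin n → ℝ)
    (hA : BlowUp.IsPosDiagonalization A S L)
    (α : ℝ) (hα : 0 < α)
    (H : EuclideanSpace ℝ (Fin n) → ℝ)
    (hHhom : BlowUp.PosHomogeneous α H)
    (hHpos : ∀ x ∈ Metric.sphere (0 : EuclideanSpace ℝ (Fin n)) 1, 0 < H x)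
    (hHcont : ContinuousOn H (Metric.sphere (0 : EuclideanSpace ℝ (Fin n)) 1))
    (t₀ T : ℝ) (ht₀ : 0 ≤ t₀) (hT : t₀ < T)
    (y f : ℝ → EuclideanSpace ℝ (Fin n)) (E₀ : ℝ → ℝ)
    (hy : ContDiffOn ℝ 1 y (Ico t₀ T))
    (hy0 : ∀ t ∈ Ico t₀ T, y t ≠ 0)
    (hblow : Tendsto (fun t => ‖y t‖) (𝓝[<] T) atTop)
    (hode : ∀ t ∈ Ioo t₀ T, HasDerivAt y (H (y t) • A.toEuclideanLin (y t) + f t) t)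
    (hf : ContinuousOn f (Ico t₀ T))
    (hfE : ∀ t ∈ Ico t₀ T, ‖f t‖ ≤ ‖y t‖ ^ (1 + α) * E₀ t)
    (hE0 : ∀ t ∈ Ico t₀ T, 0 ≤ E₀ t)
    (hEint : IntegrableOn E₀ (Ico t₀ T))
    (hElog : IntegrableOn
      (fun s => E₀ s / (T - s) * Real.log ((T - t₀) / (T - s))) (Ico t₀ T))
    (hE2 : (∃ i j, L i < L j) → IntegrableOn (fun s => (T - s)⁻¹ * E₀ s ^ 2) (Ico t₀ T)) :
    (∃! p : ℝ × EuclideanSpace ℝ (Fin n),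
      BlowUp.IsAsymptoticDirection A S L α E₀ T y p.1 p.2) ∧
    ∀ (Λ : ℝ) (vs : EuclideanSpace ℝ (Fin n)),
      BlowUp.IsAsymptoticDirection A S L α E₀ T y Λ vs →
    ∀ (s₀ : ℝ) (ω : ℝ → ℝ), BlowUp.IsOscBound H (S⁻¹.toEuclideanLin vs) s₀ ω →
    ∀ T₁ ∈ Ico t₀ T,
      (∀ t ∈ Ico T₁ T, BlowUp.frobNorm S⁻¹ * BlowUp.V2Tilde S y vs t ≤ s₀) →
      IntegrableOn (fun τ => BlowUp.calE0Tilde S L α E₀ y Λ vs ω τ / (T - τ)) (Ico T₁ T) →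
    ∃ ξ : EuclideanSpace ℝ (Fin n),
      Module.End.HasEigenvector A.toEuclideanLin Λ ξ ∧
      α * Λ * H ξ = 1 ∧
      Tendsto (fun t => (T - t) ^ (1 / α) • y t) (𝓝[<] T) (𝓝 ξ) ∧
      (fun t => (T - t) ^ (1 / α) * ‖(1 - BlowUp.proj S L Λ).toEuclideanLin (y t)‖)
        =O[𝓝[<] T] BlowUp.V1Tilde S L Λ y ∧
      (fun t => (T - t) ^ (1 / α) • (BlowUp.proj S L Λ).toEuclideanLin (y t) - ξ)
        =O[𝓝[<] T] BlowUp.calE1Tilde S L α E₀ T y Λ vs ω ∧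
      (fun t => (T - t) ^ (1 / α) • y t - ξ)
        =O[𝓝[<] T] fun t =>
          BlowUp.V1Tilde S L Λ y t + BlowUp.calE1Tilde S L α E₀ T y Λ vs ω t := by
  have P := BlowUp.perturbedFlow_conj hA hα hHhom hHpos hHcont hT hy0 hblow hode hfE hE0 hEint hElog
  refine ⟨?_, ?_⟩
  · obtain ⟨Λ, vs, hd⟩ := BlowUp.exists_isAsymptoticDirection hA P
    refine ⟨(Λ, vs), hd, fun p hp => ?_⟩
    obtain ⟨h1, h2⟩ := BlowUp.IsAsymptoticDirection.unique P hp hd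
    exact Prod.ext h1 h2
  intro Λ vs hd s₀ ω hω T₁ hT₁ hs₀ hint
  have hint' := hint.mono_set (Ioo_subset_Ico_self (a := T₁) (b := T))
  have hsub : Ioo T₁ T ⊆ Ioo t₀ T := Ioo_subset_Ioo_left hT₁.1
  have hΛ := hd.pos P
  have hvs0 : vs ≠ 0 := norm_ne_zero_iff.1 (by rw [hd.unit]; exact one_ne_zero)
  have hHs : 0 < H (S⁻¹.toEuclideanLin vs) := by
    obtain ⟨p₁, p₂, hp₁, hp⟩ := P.bounds
    exact hp₁.trans_le (hp vs hd.unit).1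
  set z := fun t => S.toEuclideanLin (y t) with hz
  set F := BlowUp.calE0Tilde S L α E₀ y Λ vs ω with hFdef
  have hcal : BlowUp.calE1Tilde S L α E₀ T y Λ vs ω = fun t => ∫ s in t..T, F s / (T - s) := rfl
  have hle : ∀ t ∈ Ioo T₁ T, BlowUp.V1Tilde S L Λ y t + BlowUp.E0Tilde S α E₀ t ≤ F t := by
    intro t ht
    have h1 : 0 ≤ ω (BlowUp.frobNorm S⁻¹ * BlowUp.V2Tilde S y vs t) :=
      hω.nonneg _ ⟨mul_nonneg (BlowUp.frobNorm_nonneg _) (norm_nonneg _),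
      hs₀ t (Ioo_subset_Ico_self ht)⟩
    rw [hFdef, BlowUp.calE0Tilde_eq]
    linarith
  have hF0 : ∀ t ∈ Ioo T₁ T, 0 ≤ F t := fun t ht =>
    (add_nonneg (BlowUp.V1Tilde_nonneg S L Λ y t) (P.nonneg t (hsub ht))).trans (hle t ht)
  obtain ⟨K, hK, hgrowth⟩ := BlowUp.exists_growth_bound (Λ := Λ) hA P hω hT₁.1 hs₀
  have hκ : 0 < H (S⁻¹.toEuclideanLin vs) * Λ := mul_pos hHs hΛ
  have hsize := P.isBigO_norm hκ hT₁.1 hT₁.2 hint' hK hF0 hgrowth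
  have hproj := hd.isBigO_proj P hT₁.1 hT₁.2 hint' hle
  have hακ : 0 < α * (H (S⁻¹.toEuclideanLin vs) * Λ) := mul_pos hα hκ
  -- `μ` is the limit of `(T - t)^(1/α) |z|`, so the blow-up profile is `ξ = S⁻¹ (μ vs)`.
  set μ := (α * (H (S⁻¹.toEuclideanLin vs) * Λ)) ^ (-(1 / α)) with hμ
  have hμ0 : 0 < μ := Real.rpow_pos_of_pos hακ _
  have hcal0 := BlowUp.tendsto_integral_left hT₁.2 hint'
  have hφ : Tendsto (fun t => (T - t) ^ (1 / α) * ‖z t‖) (𝓝[<] T) (𝓝 μ) := by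
    simpa using (hsize.trans_tendsto hcal0).add_const μ
  have hφ1 := hφ.isBigO_one ℝ
  have hcomp : (fun t => (T - t) ^ (1 / α) * ‖(1 - BlowUp.proj S L Λ).toEuclideanLin (y t)‖)
      =O[𝓝[<] T] BlowUp.V1Tilde S L Λ y := by
    have h1 : (fun t => (T - t) ^ (1 / α) * ‖(1 - BlowUp.proj S L Λ).toEuclideanLin (y t)‖)
        =O[𝓝[<] T] fun t => (T - t) ^ (1 / α) * ‖z t‖ * BlowUp.V1Tilde S L Λ y t := by
      refine IsBigO.of_bound (BlowUp.frobNorm S⁻¹) ?_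
      filter_upwards [Ioo_mem_nhdsLT hT] with t ht
      have hTt : 0 ≤ (T - t) ^ (1 / α) := Real.rpow_nonneg (sub_pos.2 ht.2).le _
      have hV := BlowUp.V1Tilde_nonneg S L Λ y t
      have h2 : (1 - BlowUp.proj S L Λ).toEuclideanLin (y t)
          = ‖z t‖ • S⁻¹.toEuclideanLin
            (BlowUp.dir z t - BlowUp.matCLM (BlowUp.projHat L Λ) (BlowUp.dir z t)) := by
        rw [← map_smul, smul_sub, ← map_smul, P.norm_smul_dir ht,
          BlowUp.toEuclideanLin_one_sub_apply, BlowUp.proj, BlowUp.toEuclideanLin_mul_apply,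
          BlowUp.toEuclideanLin_mul_apply, map_sub, hz, hA.inv_apply, BlowUp.matCLM_apply]
      rw [h2, norm_smul, norm_norm, Real.norm_of_nonneg (by positivity),
        Real.norm_of_nonneg (by positivity)]
      have h3 := BlowUp.norm_toEuclideanLin_le S⁻¹
        (BlowUp.dir z t - BlowUp.matCLM (BlowUp.projHat L Λ) (BlowUp.dir z t))
      rw [← BlowUp.V1Tilde_eq] at h3
      calc _ ≤ (T - t) ^ (1 / α) * (‖z t‖ * (BlowUp.frobNorm S⁻¹ * BlowUp.V1Tilde S L Λ y t)) := by
            gcongr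
        _ = _ := by ring
    refine h1.trans ?_
    simpa using hφ1.mul (isBigO_refl (BlowUp.V1Tilde S L Λ y) (𝓝[<] T))
  have heig : (fun t => (T - t) ^ (1 / α) • (BlowUp.proj S L Λ).toEuclideanLin (y t)
      - S⁻¹.toEuclideanLin (μ • vs)) =O[𝓝[<] T] BlowUp.calE1Tilde S L α E₀ T y Λ vs ω := by
    rw [hcal]
    -- With `φ = (T - t)^(1/α) |z|`, the splitting `φ R v - μ vs = φ (R v - vs) + (φ - μ) vs`
    -- separates the direction error from the size error.
    have h1 : (fun t => ((T - t) ^ (1 / α) * ‖z t‖) •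
        (BlowUp.matCLM (BlowUp.projHat L Λ) (BlowUp.dir z t) - vs)
        + ((T - t) ^ (1 / α) * ‖z t‖ - μ) • vs)
        =O[𝓝[<] T] fun t => ∫ s in t..T, F s / (T - s) := by
      refine IsBigO.add ?_ ?_
      · simpa using hφ1.smul hproj
      · refine IsBigO.trans (IsBigO.of_bound 1 (Eventually.of_forall fun t => ?_)) hsize
        rw [norm_smul, hd.unit, mul_one, one_mul]
    refine (((BlowUp.matCLM S⁻¹).isBigO_comp _ _).trans h1).congr' ?_ EventuallyEq.rfl
    filter_upwards [Ioo_mem_nhdsLT hT] with t ht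
    have h2 : (BlowUp.proj S L Λ).toEuclideanLin (y t)
        = S⁻¹.toEuclideanLin (‖z t‖ • BlowUp.matCLM (BlowUp.projHat L Λ) (BlowUp.dir z t)) := by
      rw [← map_smul, P.norm_smul_dir ht, BlowUp.proj, BlowUp.toEuclideanLin_mul_apply,
        BlowUp.toEuclideanLin_mul_apply, BlowUp.matCLM_apply]
    rw [h2, ← map_smul, ← map_sub, BlowUp.matCLM_apply]
    congr 1
    rw [smul_sub, sub_smul, smul_smul]
    abel
  have htot : (fun t => (T - t) ^ (1 / α) • y t - S⁻¹.toEuclideanLin (μ • vs))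
      =O[𝓝[<] T] fun t =>
        BlowUp.V1Tilde S L Λ y t + BlowUp.calE1Tilde S L α E₀ T y Λ vs ω t := by
    have hnn : ∀ᶠ t in 𝓝[<] T, 0 ≤ BlowUp.V1Tilde S L Λ y t ∧
        0 ≤ BlowUp.calE1Tilde S L α E₀ T y Λ vs ω t := by
      filter_upwards [Ioo_mem_nhdsLT hT₁.2] with t ht
      exact ⟨BlowUp.V1Tilde_nonneg S L Λ y t, BlowUp.integral_div_nonneg ht hF0⟩
    have h1 : BlowUp.V1Tilde S L Λ y =O[𝓝[<] T] fun t =>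
        BlowUp.V1Tilde S L Λ y t + BlowUp.calE1Tilde S L α E₀ T y Λ vs ω t := by
      refine IsBigO.of_bound 1 ?_
      filter_upwards [hnn] with t ht
      rw [Real.norm_of_nonneg ht.1, Real.norm_of_nonneg (add_nonneg ht.1 ht.2)]
      linarith
    have h2 : BlowUp.calE1Tilde S L α E₀ T y Λ vs ω =O[𝓝[<] T] fun t =>
        BlowUp.V1Tilde S L Λ y t + BlowUp.calE1Tilde S L α E₀ T y Λ vs ω t := by
      refine IsBigO.of_bound 1 ?_
      filter_upwards [hnn] with t ht
      rw [Real.norm_of_nonneg ht.2, Real.norm_of_nonneg (add_nonneg ht.1 ht.2)]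
      linarith
    have h3 : (fun t => (T - t) ^ (1 / α) • (1 - BlowUp.proj S L Λ).toEuclideanLin (y t))
        =O[𝓝[<] T] BlowUp.V1Tilde S L Λ y := by
      refine IsBigO.trans (IsBigO.of_bound 1 ?_) hcomp
      filter_upwards with t
      rw [norm_smul, norm_mul, norm_norm, one_mul]
    refine ((heig.trans h2).add (h3.trans h1)).congr_left fun t => ?_
    rw [BlowUp.toEuclideanLin_one_sub_apply, smul_sub]
    abel
  refine ⟨S⁻¹.toEuclideanLin (μ • vs), ?_, ?_, ?_, hcomp, heig, htot⟩
  · refine hA.hasEigenvector (smul_ne_zero hμ0.ne' hvs0) ?_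
    rw [map_smul, hd.diagonal_apply P, smul_comm]
  -- By homogeneity `H(ξ) = μ^α H(v_*)`, and `μ^α` is the inverse of `α Λ H(v_*)`.
  · rw [map_smul, hHhom _ (hA.inv_ne_zero hvs0) _ hμ0, hμ, ← Real.rpow_mul hακ.le,
      show -(1 / α) * α = -1 by field_simp, Real.rpow_neg_one]
    field_simp
  · have h1 : Tendsto (fun t => BlowUp.V1Tilde S L Λ y t
        + BlowUp.calE1Tilde S L α E₀ T y Λ vs ω t) (𝓝[<] T) (𝓝 0) := by
      simpa [hcal] using hd.tendsto_V1.add hcal0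
    simpa using (htot.trans_tendsto h1).add_const (S⁻¹.toEuclideanLin (μ • vs))
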